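/- Let $V$ be the $5$-dimensional space of real symmetric $3\times 3$ matrices $\sigma=(\sigma_{kl})$ with $\sigma_{22}=\sigma_{13}+\sigma_{31}=2\sigma_{13}$, with the basis $\sigma_1=2E_{11}$, $\sigma_2=E_{12}+E_{21}$, $\sigma_3=E_{13}+2E_{22}+E_{31}$, $\sigma_4=E_{23}+E_{32}$, $\sigma_5=2E_{33}$, where $E_{kl}$ are the matrix units. Let $W\subset\wedge^2V$ be the span of $\sigma_1\wedge\sigma_4-\sigma_2\wedge\sigma_3$, $\sigma_1\wedge\sigma_5-\sigma_2\wedge\sigma_4$ and $\sigma_2\wedge\sigma_5-\sigma_3\wedge\sigma_4$, and put $V'=(\wedge^2V)/W$. Let $\mathcal G=V\oplus V'$ be the $2$-step nilpotent Lie algebra in which $[v_1,v_2]=v_1\wedge v_2 \bmod W$ for $v_1,v_2\in V$ and $[x,y]=0$ for $x\in\mathcal G$, $y\in V'$, and let $G$ be the simply connected Lie group with Lie algebra $\mathcal G$. Its commutator subgroup $[G,G]$ is central and is identified with the vector space $V'$ by the exponential map. There is a set $E\subset[G,G]$ of Lebesgue measure $0$ such that for every $\theta\in[G,G]\setminus E$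 the quotient $G'=G/\Theta$ by the cyclic subgroup $\Theta$ generated by $\theta$ has the following properties, where $\mathrm{Aut}(G')$ denotes the group of continuous automorphisms of $G'$. 1. The commutator subgroup $[G',G']$ is closed in $G'$. 2. For every $\tau\in\mathrm{Aut}(G')$ the automorphism of $G'/[G',G']$ induced by $\tau$ is $I$ or $-I$, where $I$ is the identity and $-I$ is the map $x\mapsto x^{-1}$ of this abelian group. 3. For every $g\in G'\setminus[G',G']$ the $\mathrm{Aut}(G')$-orbit of $g$ is the union of the two distinct cosets $g[G',G']$ and $g^{-1}[G',G']$. Every $g\in[G',G']$ is fixed by $\mathrm{Aut}(G')$, so that its orbit is $\{g\}$. -/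

import Mathlib

open Matrix

namespace SmallAut

/-- The five-dimensional space of real symmetric `3 × 3` matrices with
`σ₂₂ = σ₁₃ + σ₃₁ = 2 σ₁₃` (indices of `Fin 3` start at `0`). -/
def V : Submodule ℝ (Matrix (Fin 3) (Fin 3) ℝ) where
  carrier := {M | Mᵀ = M ∧ M 1 1 = 2 * M 0 2}
  zero_mem' := by simp
  add_mem' := by
    rintro A B ⟨hA, hA'⟩ ⟨hB, hB'⟩
    refine ⟨by rw [transpose_add, hA, hB], ?_⟩
    simp only [Matrix.add_apply, hA', hB']
    ring
  smul_mem' := by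
    rintro c A ⟨hA, hA'⟩
    refine ⟨by rw [transpose_smul, hA], ?_⟩
    simp only [Matrix.smul_apply, smul_eq_mul, hA']
    ring

/-- `σ₁ = 2E₁₁`. -/
def σ₁ : V := ⟨!![2, 0, 0; 0, 0, 0; 0, 0, 0],
  by ext i j; fin_cases i <;> fin_cases j <;> simp, by simp⟩

/-- `σ₂ = E₁₂ + E₂₁`. -/
def σ₂ : V := ⟨!![0, 1, 0; 1, 0, 0; 0, 0, 0],
  by ext i j; fin_cases i <;> fin_cases j <;> simp, by simp⟩

/-- `σ₃ = E₁₃ + 2E₂₂ + E₃₁`. -/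
def σ₃ : V := ⟨!![0, 0, 1; 0, 2, 0; 1, 0, 0],
  by ext i j; fin_cases i <;> fin_cases j <;> simp, by simp⟩

/-- `σ₄ = E₂₃ + E₃₂`. -/
def σ₄ : V := ⟨!![0, 0, 0; 0, 0, 1; 0, 1, 0],
  by ext i j; fin_cases i <;> fin_cases j <;> simp, by simp⟩

/-- `σ₅ = 2E₃₃`. -/
def σ₅ : V := ⟨!![0, 0, 0; 0, 0, 0; 0, 0, 2],
  by ext i j; fin_cases i <;> fin_cases j <;> simp, by simp⟩

/-- `v ∧ w` in the second exterior power of `V`. -/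
noncomputable def wedge (v w : V) : ⋀[ℝ]^2 V := exteriorPower.ιMulti ℝ 2 ![v, w]

/-- The subspace `W` of `⋀² V` by which the free bracket is divided. -/
noncomputable def W : Submodule ℝ (⋀[ℝ]^2 V) :=
  Submodule.span ℝ {wedge σ₁ σ₄ - wedge σ₂ σ₃, wedge σ₁ σ₅ - wedge σ₂ σ₄,
    wedge σ₂ σ₅ - wedge σ₃ σ₄}

/-- `V' = (⋀² V) / W`. -/
abbrev V' : Type := (⋀[ℝ]^2 V) ⧸ W

theorem wedge_self (v : V) : wedge v v = 0 :=
  (exteriorPower.ιMulti ℝ 2).map_eq_zero_of_eq ![v, v] (i := 0) (j := 1) rfl (by simp)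

theorem update_zero_pair (u v w : V) : Function.update ![u, v] 0 w = ![w, v] := by
  ext i : 1
  fin_cases i <;> rfl

theorem update_one_pair (u v w : V) : Function.update ![u, v] 1 w = ![u, w] := by
  ext i : 1
  fin_cases i <;> rfl

theorem wedge_add_left (u v w : V) : wedge (u + v) w = wedge u w + wedge v w := by
  have := (exteriorPower.ιMulti ℝ 2 (M := V)).map_update_add ![u, w] 0 u v
  rwa [update_zero_pair, update_zero_pair, update_zero_pair] at this

theorem wedge_add_right (u v w : V) : wedge u (v + w) = wedge u v + wedge u w := by
  have := (exteriorPower.ιMulti ℝ 2 (M := V)).map_update_add ![u, v] 1 v w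
  rwa [update_one_pair, update_one_pair, update_one_pair] at this

theorem wedge_smul_left (c : ℝ) (v w : V) : wedge (c • v) w = c • wedge v w := by
  have := (exteriorPower.ιMulti ℝ 2 (M := V)).map_update_smul ![v, w] 0 c v
  rwa [update_zero_pair, update_zero_pair] at this

theorem wedge_smul_right (c : ℝ) (v w : V) : wedge v (c • w) = c • wedge v w := by
  have := (exteriorPower.ιMulti ℝ 2 (M := V)).map_update_smul ![v, w] 1 c w
  rwa [update_one_pair, update_one_pair] at this

/-- The bilinear map `(v, w) ↦ v ∧ w mod W`. -/
noncomputable def wedgeMod : V →ₗ[ℝ] V →ₗ[ℝ] V' :=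
  LinearMap.mk₂ ℝ (fun v w => W.mkQ (wedge v w))
    (fun u v w => by rw [wedge_add_left, map_add])
    (fun c v w => by rw [wedge_smul_left, map_smul])
    (fun u v w => by rw [wedge_add_right, map_add])
    (fun c v w => by rw [wedge_smul_right, map_smul])

theorem wedgeMod_self (v : V) : wedgeMod v v = 0 := by
  simp [wedgeMod, wedge_self]

/-- The vector space `V ⊕ V'` underlying the two-step nilpotent Lie algebra. -/
def NilAlg : Type := V × V'

noncomputable instance : AddCommGroup NilAlg := inferInstanceAs (AddCommGroup (V × V'))
noncomputable instance : Module ℝ NilAlg := inferInstanceAs (Module ℝ (V × V'))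
instance : Module.Finite ℝ NilAlg := inferInstanceAs (Module.Finite ℝ (V × V'))

/-- The Lie bracket: `[v₁, v₂] = v₁ ∧ v₂ mod W` on `V`, and `V'` is central. -/
noncomputable instance : Bracket NilAlg NilAlg where
  bracket x y := (0, wedgeMod x.1 y.1)

theorem bracket_fst (x y : NilAlg) : (⁅x, y⁆ : NilAlg).1 = 0 := rfl

theorem bracket_snd (x y : NilAlg) : (⁅x, y⁆ : NilAlg).2 = wedgeMod x.1 y.1 := rfl

theorem add_fst (x y : NilAlg) : (x + y).1 = x.1 + y.1 := rfl
theorem add_snd (x y : NilAlg) : (x + y).2 = x.2 + y.2 := rfl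
theorem neg_fst (x : NilAlg) : (-x).1 = -x.1 := rfl
theorem neg_snd (x : NilAlg) : (-x).2 = -x.2 := rfl
theorem smul_fst (c : ℝ) (x : NilAlg) : (c • x).1 = c • x.1 := rfl
theorem smul_snd (c : ℝ) (x : NilAlg) : (c • x).2 = c • x.2 := rfl
theorem zero_fst : (0 : NilAlg).1 = 0 := rfl
theorem zero_snd : (0 : NilAlg).2 = 0 := rfl

theorem NilAlg.ext {x y : NilAlg} (h₁ : x.1 = y.1) (h₂ : x.2 = y.2) : x = y :=
  Prod.ext h₁ h₂

noncomputable instance : LieRing NilAlg where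
  add_lie x y z := by
    apply NilAlg.ext <;> simp [bracket_fst, bracket_snd, add_fst, add_snd]
  lie_add x y z := by
    apply NilAlg.ext <;> simp [bracket_fst, bracket_snd, add_fst, add_snd]
  lie_self x := by
    apply NilAlg.ext <;> simp [bracket_fst, bracket_snd, zero_fst, zero_snd, wedgeMod_self]
  leibniz_lie x y z := by
    apply NilAlg.ext <;>
      simp only [bracket_fst, bracket_snd, add_fst, add_snd, map_zero, LinearMap.zero_apply,
        add_zero]

noncomputable instance : LieAlgebra ℝ NilAlg where
  lie_smul c x y := by
    apply NilAlg.ext <;> simp [bracket_fst, bracket_snd, smul_fst, smul_snd]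

theorem lie_lie_eq_zero (x y z : NilAlg) : ⁅x, ⁅y, z⁆⁆ = 0 := by
  apply NilAlg.ext <;>
    simp only [bracket_fst, bracket_snd, zero_fst, zero_snd, map_zero]

theorem lie_lie_eq_zero' (x y z : NilAlg) : ⁅⁅x, y⁆, z⁆ = 0 := by
  apply NilAlg.ext <;>
    simp only [bracket_fst, bracket_snd, zero_fst, zero_snd, map_zero, LinearMap.zero_apply]

/-- The simply connected nilpotent Lie group with Lie algebra `NilAlg`: the exponential map is
a homeomorphism from the Lie algebra, and the product is given by the
Baker–Campbell–Hausdorff formula, which for a two-step nilpotent Lie algebra reads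
`exp x * exp y = exp (x + y + ½ [x, y])`. -/
@[ext]
structure NilGroup : Type where
  exp ::
  /-- The inverse of the exponential map. -/
  log : NilAlg

namespace NilGroup

noncomputable instance : Mul NilGroup where
  mul g h := exp (g.log + h.log + (1 / 2 : ℝ) • ⁅g.log, h.log⁆)

noncomputable instance : One NilGroup where
  one := exp 0

noncomputable instance : Inv NilGroup where
  inv g := exp (-g.log)

theorem log_mul (g h : NilGroup) :
    (g * h).log = g.log + h.log + (1 / 2 : ℝ) • ⁅g.log, h.log⁆ := rfl

theorem log_one : (1 : NilGroup).log = 0 := rfl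

theorem log_inv (g : NilGroup) : (g⁻¹).log = -g.log := rfl

noncomputable instance : Group NilGroup :=
  Group.ofLeftAxioms
    (fun a b c => by
      ext
      simp only [log_mul, add_lie, lie_add, smul_lie, lie_smul, lie_lie_eq_zero,
        lie_lie_eq_zero', smul_add, smul_zero]
      abel)
    (fun a => by ext; simp [log_mul, log_one])
    (fun a => by ext; simp [log_mul, log_one, log_inv])

/-- The canonical topology of the finite-dimensional real vector space `NilAlg`, transported by
the exponential map. -/
noncomputable instance : TopologicalSpace NilGroup :=
  TopologicalSpace.induced log (moduleTopology ℝ NilAlg)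

/-- `exp` is a homeomorphism. -/
noncomputable def logHomeomorph :
    letI := moduleTopology ℝ NilAlg
    NilGroup ≃ₜ NilAlg :=
  letI := moduleTopology ℝ NilAlg
  { toFun := log
    invFun := exp
    left_inv := fun _ => rfl
    right_inv := fun _ => rfl
    continuous_toFun := continuous_induced_dom
    continuous_invFun := continuous_induced_rng.2 continuous_id }

instance : IsTopologicalGroup NilGroup := by
  let _ : TopologicalSpace NilAlg := moduleTopology ℝ NilAlg
  have : IsModuleTopology ℝ NilAlg := ⟨rfl⟩
  have := IsModuleTopology.topologicalAddGroup ℝ NilAlg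
  have hlog : Continuous log := logHomeomorph.continuous
  have := IsModuleTopology.toContinuousSMul ℝ NilAlg
  let B : NilAlg →ₗ[ℝ] NilAlg →ₗ[ℝ] NilAlg :=
    LinearMap.mk₂ ℝ (fun x y => ⁅x, y⁆) add_lie smul_lie lie_add lie_smul
  have hB : Continuous fun p : NilAlg × NilAlg => B p.1 p.2 :=
    IsModuleTopology.continuous_bilinear_of_finite_left B
  refine { continuous_mul := continuous_induced_rng.2 ?_,
           continuous_inv := continuous_induced_rng.2 ?_ }
  · have h₁ : Continuous fun p : NilGroup × NilGroup => p.1.log := hlog.comp continuous_fst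
    have h₂ : Continuous fun p : NilGroup × NilGroup => p.2.log := hlog.comp continuous_snd
    have h₃ : Continuous fun p : NilGroup × NilGroup => B p.1.log p.2.log :=
      Continuous.comp (g := fun p : NilAlg × NilAlg => B p.1 p.2)
        (f := fun p : NilGroup × NilGroup => (p.1.log, p.2.log)) hB (h₁.prodMk h₂)
    have h₄ : Continuous fun p : NilGroup × NilGroup => (1 / 2 : ℝ) • B p.1.log p.2.log :=
      h₃.const_smul (1 / 2 : ℝ)
    exact (h₁.add h₂).add h₄
  · exact hlog.neg

instance : SimplyConnectedSpace NilGroup := by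
  let _ : TopologicalSpace NilAlg := moduleTopology ℝ NilAlg
  have : IsModuleTopology ℝ NilAlg := ⟨rfl⟩
  have := IsModuleTopology.topologicalAddGroup ℝ NilAlg
  have : ContractibleSpace NilGroup := logHomeomorph.contractibleSpace
  infer_instance

/-- The group commutator corresponds to the Lie bracket. -/
theorem log_commutator (g h : NilGroup) :
    (g * h * g⁻¹ * h⁻¹).log = ⁅g.log, h.log⁆ := by
  simp only [log_mul, log_inv, add_lie, smul_lie, lie_lie_eq_zero', smul_zero,
    lie_neg, neg_lie, lie_self, zero_lie]
  have hs : ⁅h.log, g.log⁆ = -⁅g.log, h.log⁆ := (lie_skew _ _).symm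
  rw [hs]
  module

/-- The projection of `G` to `V`, a group homomorphism. -/
noncomputable def toV : NilGroup →* Multiplicative V where
  toFun g := Multiplicative.ofAdd g.log.1
  map_one' := rfl
  map_mul' g h := by
    rw [← ofAdd_add, log_mul, add_fst, add_fst, smul_fst, bracket_fst, smul_zero, add_zero]

/-- `[G, G]` is the image of `V'` under the exponential map. -/
theorem mem_commutator_iff (g : NilGroup) : g ∈ commutator NilGroup ↔ g.log.1 = 0 := by
  constructor
  · intro hg
    exact Multiplicative.ofAdd.injective
      (MonoidHom.mem_ker.1 (Abelianization.commutator_subset_ker toV hg))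
  · have key : ∀ x ∈ Submodule.span ℝ (Set.range (exteriorPower.ιMulti ℝ 2 (M := V))),
        ∀ c : ℝ, exp (0, W.mkQ (c • x)) ∈ commutator NilGroup := by
      intro x hx
      induction hx using Submodule.span_induction with
      | mem x hx =>
        obtain ⟨f, rfl⟩ := hx
        intro c
        have : exp (0, W.mkQ (c • exteriorPower.ιMulti ℝ 2 f)) =
            exp (c • f 0, 0) * exp (f 1, 0) * (exp (c • f 0, 0))⁻¹ * (exp (f 1, 0))⁻¹ := by
          ext1
          rw [log_commutator]
          apply NilAlg.ext
          · rfl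
          · change W.mkQ _ = W.mkQ (wedge (c • f 0) (f 1))
            rw [wedge_smul_left, wedge]
            have hf : f = ![f 0, f 1] := by
              ext i : 1
              fin_cases i <;> rfl
            rw [← hf]
        rw [this]
        exact Subgroup.commutator_mem_commutator (Subgroup.mem_top _) (Subgroup.mem_top _)
      | zero =>
        intro c
        rw [smul_zero, map_zero]
        exact one_mem _
      | add x y _ _ hx hy =>
        intro c
        have : exp (0, W.mkQ (c • (x + y))) =
            exp (0, W.mkQ (c • x)) * exp (0, W.mkQ (c • y)) := by
          ext1
          rw [log_mul]
          apply NilAlg.ext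
          · change (0 : V) = 0 + 0 + (1 / 2 : ℝ) • (0 : V)
            simp
          · change W.mkQ (c • (x + y)) =
              W.mkQ (c • x) + W.mkQ (c • y) + (1 / 2 : ℝ) • wedgeMod 0 0
            simp only [smul_add, map_add, map_zero, smul_zero, add_zero]
        rw [this]
        exact mul_mem (hx c) (hy c)
      | smul a x _ hx =>
        intro c
        rw [smul_smul]
        exact hx _
    intro hg
    obtain ⟨x, hx⟩ := W.mkQ_surjective g.log.2
    have h := key x (by rw [exteriorPower.ιMulti_span]; trivial) 1
    rw [one_smul, hx, ← hg] at h
    exact h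

theorem commutator_le_center : commutator NilGroup ≤ Subgroup.center NilGroup := by
  intro g hg
  rw [mem_commutator_iff] at hg
  rw [Subgroup.mem_center_iff]
  intro h
  ext1
  rw [log_mul, log_mul, add_comm g.log h.log]
  congr 2
  apply NilAlg.ext <;> simp [bracket_fst, bracket_snd, hg]

instance (θ : commutator NilGroup) : (Subgroup.zpowers (θ : NilGroup)).Normal := by
  have h : Subgroup.zpowers (θ : NilGroup) ≤ Subgroup.center NilGroup :=
    Subgroup.zpowers_le.2 (commutator_le_center θ.2)
  refine ⟨fun n hn g => ?_⟩
  rw [Subgroup.mem_center_iff.1 (h hn) g, mul_inv_cancel_right]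
  exact hn

end NilGroup

/-- A subset of `[G, G]` is Lebesgue-null if its image in the real vector space `V'` (to which
`[G, G]` is identified by the logarithm) has Lebesgue measure zero in linear coordinates. -/
def IsLebesgueNull (E : Set (commutator NilGroup)) : Prop :=
  MeasureTheory.volume
    ((fun θ : commutator NilGroup => (Module.finBasis ℝ V').equivFun (θ : NilGroup).log.2) '' E)
    = 0

/-- `G' = G / ⟨θ⟩`, with the quotient topology. -/
abbrev Quo (θ : commutator NilGroup) : Type := NilGroup ⧸ Subgroup.zpowers (θ : NilGroup)

/-- The automorphism of `G / [G, G]` induced by a continuous automorphism `τ` of a topological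
group `G`. -/
def factor {G : Type*} [Group G] [TopologicalSpace G] (τ : G ≃ₜ* G) :
    G ⧸ commutator G ≃* G ⧸ commutator G :=
  QuotientGroup.congr (commutator G) (commutator G) τ.toMulEquiv
    (Subgroup.characteristic_iff_map_eq.1 inferInstance τ.toMulEquiv)

/-- The orbit of `g` under the group of continuous automorphisms (with continuous inverse) of a
topological group `G`. -/
def autOrbit {G : Type*} [Group G] [TopologicalSpace G] (g : G) : Set G :=
  Set.range fun τ : G ≃ₜ* G => τ g

end SmallAut

open scoped Pointwise

/-! Rigidity. By continuity an automorphism of `G'` induces a linear map `α` of `V`, and commutators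
show that it acts on `[G', G']` through `⋀² α`. This action descends from `V'` to `V'/ℤy` with `y =
log θ`. A real line whose image lies in `ℤy` must vanish, so `⋀² α` preserves `W`; applied also to
the inverse automorphism, the argument shows that `⋀² α` sends `y` to `±y`.

Every nonzero element of `W ≅ ℝ³` is a bivector of rank four whose kernel in the dual of `V` is
spanned by an evaluation `v ↦ xᵀvx`. A map preserving `W` therefore permutes these evaluations up to
scale, which makes `α` a congruence `γᵀ α(v) γ = μ v` (`exists_congruence`). Since `J` spans the
trace-orthogonal complement of `V` in the symmetric matrices, `γ` is a similitude of `J`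
(`congruence_preserves_J`). Seven linear forms vanishing on `W` turn elements of `V'` into
`J`-harmonic cubic tensors, and this passage is equivariant up to a scalar
(`pull_tensor_wedgeCoeffs`).

A generic cubic tensor `F` yields an endomorphism `N` and a vector `L`. If `γ` fixes `F` up to
scale, then `γ` commutes with `N` and has `L` as an eigenvector; if `L` is cyclic for `N`, then `γ`
is scalar (`scalar_of_pull_eq`). Hence `α` is a scalar `a` with `a² = ±1`, so `a = ±1`, and `⋀² α`
is the identity. Genericity is the non-vanishing of a nonzero homogeneous polynomial, so the
exceptional set is null (`volume_degenerate`).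

Transitivity. The maps `(v, y) ↦ (±v, y + βv)`, with `β : V → V'` any linear map, are automorphisms
of the Lie algebra that fix `V'` pointwise. They descend to `G'`, and for `v ≠ 0` the value `βv` is
arbitrary, so each orbit outside `[G', G']` fills both cosets. -/

namespace SmallAut

/-! ### Linear algebra of the exterior square -/

/-- The linear map on `⋀² V` induced by an alternating bilinear map. -/
noncomputable def wedgeLift {N : Type*} [AddCommGroup N] [Module ℝ N] (B : V →ₗ[ℝ] V →ₗ[ℝ] N)
    (hB : ∀ v, B v v = 0) : ⋀[ℝ]^2 V →ₗ[ℝ] N :=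
  exteriorPower.alternatingMapLinearEquiv
    { toFun := fun m => B (m 0) (m 1)
      map_update_add' := by
        intro _ m i x y
        fin_cases i <;> simp [Function.update]
      map_update_smul' := by
        intro _ m i c x
        fin_cases i <;> simp [Function.update]
      map_eq_zero_of_eq' := by
        intro m i j hij hne
        have : m 0 = m 1 := by
          fin_cases i <;> fin_cases j <;> simp_all
        rw [this, hB] }

theorem wedgeLift_wedge {N : Type*} [AddCommGroup N] [Module ℝ N] (B : V →ₗ[ℝ] V →ₗ[ℝ] N)
    (hB : ∀ v, B v v = 0) (v w : V) : wedgeLift B hB (wedge v w) = B v w := by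
  simp [wedgeLift, wedge, exteriorPower.alternatingMapLinearEquiv_apply_ιMulti]

theorem linearMap_ext_wedge {N : Type*} [AddCommGroup N] [Module ℝ N]
    {f g : ⋀[ℝ]^2 V →ₗ[ℝ] N} (h : ∀ v w, f (wedge v w) = g (wedge v w)) : f = g := by
  apply exteriorPower.linearMap_ext
  ext m
  have hm : m = ![m 0, m 1] := by
    ext i : 1
    fin_cases i <;> rfl
  have := h (m 0) (m 1)
  rw [wedge, ← hm] at this
  exact this

theorem map_wedge (α : V →ₗ[ℝ] V) (v w : V) :
    exteriorPower.map 2 α (wedge v w) = wedge (α v) (α w) := by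
  rw [wedge, exteriorPower.map_apply_ιMulti, wedge]
  congr 1
  ext i : 1
  fin_cases i <;> rfl

/-- The contraction `v ∧ w ↦ φ(v) w - φ(w) v` with a linear form `φ`. -/
noncomputable def contract (φ : V →ₗ[ℝ] ℝ) : ⋀[ℝ]^2 V →ₗ[ℝ] V :=
  wedgeLift (LinearMap.mk₂ ℝ (fun v w => φ v • w - φ w • v)
    (by intros; simp only [map_add]; module) (by intros; simp only [map_smul, smul_eq_mul]; module)
    (by intros; simp only [map_add]; module) (by intros; simp only [map_smul, smul_eq_mul]; module))
    (by intro v; simp)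

theorem contract_wedge (φ : V →ₗ[ℝ] ℝ) (v w : V) :
    contract φ (wedge v w) = φ v • w - φ w • v := by
  simp [contract, wedgeLift_wedge]

theorem contract_map (φ : V →ₗ[ℝ] ℝ) (α : V →ₗ[ℝ] V) (ω : ⋀[ℝ]^2 V) :
    contract φ (exteriorPower.map 2 α ω) = α (contract (φ ∘ₗ α) ω) := by
  have : contract φ ∘ₗ exteriorPower.map 2 α = α ∘ₗ contract (φ ∘ₗ α) := by
    apply linearMap_ext_wedge
    intro v w
    simp [map_wedge, contract_wedge]
  exact LinearMap.congr_fun this ω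

/-! ### The elements of `W` as bivectors of rank four -/

/-- The value of the symmetric bilinear form with matrix `v` at `(x, y)`. -/
def formEval (x y : Fin 3 → ℝ) : V →ₗ[ℝ] ℝ where
  toFun v := x ⬝ᵥ ((v : Matrix (Fin 3) (Fin 3) ℝ) *ᵥ y)
  map_add' u v := by simp [add_mulVec]
  map_smul' c v := by simp [smul_mulVec]

theorem formEval_apply (x y : Fin 3 → ℝ) (v : V) :
    formEval x y v = x ⬝ᵥ ((v : Matrix (Fin 3) (Fin 3) ℝ) *ᵥ y) := rfl

/-- The parametrization `(a, b, c) ↦ c w₁ - b w₂ + a w₃` of `W` by its generators. -/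
noncomputable def omega : (Fin 3 → ℝ) →ₗ[ℝ] ⋀[ℝ]^2 V where
  toFun x := x 2 • (wedge σ₁ σ₄ - wedge σ₂ σ₃) - x 1 • (wedge σ₁ σ₅ - wedge σ₂ σ₄) +
    x 0 • (wedge σ₂ σ₅ - wedge σ₃ σ₄)
  map_add' x y := by simp only [Pi.add_apply]; module
  map_smul' c x := by simp only [Pi.smul_apply, smul_eq_mul, RingHom.id_apply]; module

theorem omega_apply (x : Fin 3 → ℝ) :
    omega x = x 2 • (wedge σ₁ σ₄ - wedge σ₂ σ₃) - x 1 • (wedge σ₁ σ₅ - wedge σ₂ σ₄) +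
    x 0 • (wedge σ₂ σ₅ - wedge σ₃ σ₄) := rfl

theorem range_omega : LinearMap.range omega = W := by
  apply le_antisymm
  · rintro _ ⟨x, rfl⟩
    rw [omega_apply]
    refine W.add_mem (W.sub_mem (W.smul_mem _ ?_) (W.smul_mem _ ?_)) (W.smul_mem _ ?_) <;>
      exact Submodule.subset_span (by simp)
  · refine Submodule.span_le.2 ?_
    rintro _ (rfl | rfl | rfl)
    · exact ⟨![0, 0, 1], by simp [omega_apply]⟩
    · exact ⟨![0, -1, 0], by simp [omega_apply]; module⟩
    · exact ⟨![1, 0, 0], by simp [omega_apply]⟩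

theorem V_symm (v : V) (i j : Fin 3) : v.1 i j = v.1 j i := by
  conv_lhs => rw [← v.2.1]
  rfl

theorem V_middle (v : V) : v.1 1 1 = 2 * v.1 0 2 := v.2.2

theorem V_eq (v : V) : v = (v.1 0 0 / 2) • σ₁ + v.1 0 1 • σ₂ + v.1 0 2 • σ₃ + v.1 1 2 • σ₄ +
    (v.1 2 2 / 2) • σ₅ := by
  apply Subtype.ext
  ext i j
  fin_cases i <;> fin_cases j <;>
    simp [σ₁, σ₂, σ₃, σ₄, σ₅, V_symm v 1 0, V_symm v 2 0, V_symm v 2 1, V_middle]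

theorem linearForm_ext {φ ψ : V →ₗ[ℝ] ℝ} (h₁ : φ σ₁ = ψ σ₁) (h₂ : φ σ₂ = ψ σ₂) (h₃ : φ σ₃ = ψ σ₃)
    (h₄ : φ σ₄ = ψ σ₄) (h₅ : φ σ₅ = ψ σ₅) : φ = ψ := by
  ext v
  rw [V_eq v]
  simp only [map_add, map_smul, h₁, h₂, h₃, h₄, h₅]

theorem formEval_eq (x y : Fin 3 → ℝ) (v : V) : formEval x y v =
    v.1 0 0 * x 0 * y 0 + v.1 0 1 * (x 0 * y 1 + x 1 * y 0) +
    v.1 0 2 * (x 0 * y 2 + 2 * x 1 * y 1 + x 2 * y 0) + v.1 1 2 * (x 1 * y 2 + x 2 * y 1) +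
    v.1 2 2 * x 2 * y 2 := by
  simp only [formEval_apply, dotProduct, mulVec, Fin.sum_univ_three, V_symm v 1 0, V_symm v 2 0,
    V_symm v 2 1, V_middle]
  ring

theorem formEval_σ₁ (x y : Fin 3 → ℝ) : formEval x y σ₁ = 2 * x 0 * y 0 := by
  simp [formEval_eq, σ₁]

theorem formEval_σ₂ (x y : Fin 3 → ℝ) : formEval x y σ₂ = x 0 * y 1 + x 1 * y 0 := by
  simp [formEval_eq, σ₂]

theorem formEval_σ₃ (x y : Fin 3 → ℝ) :
    formEval x y σ₃ = x 0 * y 2 + 2 * x 1 * y 1 + x 2 * y 0 := by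
  simp [formEval_eq, σ₃]

theorem formEval_σ₄ (x y : Fin 3 → ℝ) : formEval x y σ₄ = x 1 * y 2 + x 2 * y 1 := by
  simp [formEval_eq, σ₄]

theorem formEval_σ₅ (x y : Fin 3 → ℝ) : formEval x y σ₅ = 2 * x 2 * y 2 := by
  simp [formEval_eq, σ₅]

/-- The entries of the contraction of `omega x` with `φ`. -/
theorem contract_omega (φ : V →ₗ[ℝ] ℝ) (x : Fin 3 → ℝ) : contract φ (omega x) =
    (-x 2 * φ σ₄ + x 1 * φ σ₅) • σ₁ + (x 2 * φ σ₃ - x 1 * φ σ₄ - x 0 * φ σ₅) • σ₂ +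
    (-x 2 * φ σ₂ + x 0 * φ σ₄) • σ₃ + (x 2 * φ σ₁ + x 1 * φ σ₂ - x 0 * φ σ₃) • σ₄ +
    (-x 1 * φ σ₁ + x 0 * φ σ₂) • σ₅ := by
  simp only [omega_apply, map_add, map_sub, map_smul, contract_wedge]
  module

theorem sigma_comb_eq_zero {a b c d e : ℝ}
    (h : a • σ₁ + b • σ₂ + c • σ₃ + d • σ₄ + e • σ₅ = 0) :
    a = 0 ∧ b = 0 ∧ c = 0 ∧ d = 0 ∧ e = 0 := by
  have h' := congrArg Subtype.val h
  have h00 := congrFun (congrFun h' 0) 0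
  have h01 := congrFun (congrFun h' 0) 1
  have h02 := congrFun (congrFun h' 0) 2
  have h12 := congrFun (congrFun h' 1) 2
  have h22 := congrFun (congrFun h' 2) 2
  simp [σ₁, σ₂, σ₃, σ₄, σ₅] at h00 h01 h02 h12 h22
  exact ⟨h00, h01, h02, h12, h22⟩

/-- A bivector on a space of odd dimension has a nonzero kernel in the dual; here the kernel
contains evaluation of the quadratic form at `x`. -/
theorem contract_formEval_omega (x : Fin 3 → ℝ) : contract (formEval x x) (omega x) = 0 := by
  rw [contract_omega]
  have h : ∀ a b c d e : ℝ, a = 0 → b = 0 → c = 0 → d = 0 → e = 0 →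
      a • σ₁ + b • σ₂ + c • σ₃ + d • σ₄ + e • σ₅ = 0 := by
    rintro _ _ _ _ _ rfl rfl rfl rfl rfl
    simp
  apply h <;> simp [formEval_eq, σ₁, σ₂, σ₃, σ₄, σ₅] <;> ring

/-- The kernel is no larger than this line, so a bivector of `W` determines its point `x` up to
scale. This lets a map preserving `W` be read as a map of points of `ℝ³`. -/
theorem exists_eq_smul_formEval {x : Fin 3 → ℝ} (hx : x ≠ 0) {φ : V →ₗ[ℝ] ℝ}
    (h : contract φ (omega x) = 0) : ∃ r : ℝ, φ = r • formEval x x := by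
  rw [contract_omega] at h
  obtain ⟨h1, h2, h3, h4, h5⟩ := sigma_comb_eq_zero h
  have key : ∀ r : ℝ, φ σ₁ = r * (2 * x 0 * x 0) → φ σ₂ = r * (x 0 * x 1 + x 1 * x 0) →
      φ σ₃ = r * (x 0 * x 2 + 2 * x 1 * x 1 + x 2 * x 0) → φ σ₄ = r * (x 1 * x 2 + x 2 * x 1) →
      φ σ₅ = r * (2 * x 2 * x 2) → ∃ r : ℝ, φ = r • formEval x x := by
    intro r e1 e2 e3 e4 e5
    refine ⟨r, linearForm_ext ?_ ?_ ?_ ?_ ?_⟩ <;>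
      simpa only [LinearMap.smul_apply, smul_eq_mul, formEval_σ₁, formEval_σ₂, formEval_σ₃,
        formEval_σ₄, formEval_σ₅]
  generalize φ σ₁ = p₁, φ σ₂ = p₂, φ σ₃ = p₃, φ σ₄ = p₄, φ σ₅ = p₅ at *
  -- The linear system is solved recursively from `p₁` if `x 0 ≠ 0`, and from `p₅` if only `x 2 ≠ 0`
  -- is known; in the remaining case only `p₃` survives.
  by_cases h0 : x 0 = 0
  · by_cases h2' : x 2 = 0
    · have h1' : x 1 ≠ 0 := by
        intro h1'
        apply hx
        ext i
        fin_cases i <;> assumption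
      simp [h0, h2', h1'] at h1 h2 h3 h4 h5
      apply key (p₃ / (2 * x 1 ^ 2)) <;> simp [*]
      field_simp
    · have e4 : p₄ = x 1 * p₅ / x 2 := by field_simp; linarith
      have e3 : p₃ = x 1 * p₄ / x 2 := by field_simp; simp [h0] at h2; linarith
      have e2 : p₂ = 0 := by simpa [h0, h2'] using h3
      have e1 : p₁ = 0 := by simpa [h0, h2', e2] using h4
      apply key (p₅ / (2 * x 2 ^ 2)) <;> (try simp only [h0, e1, e2, e3, e4]) <;> field_simp <;> ring
  · have e2 : p₂ = x 1 * p₁ / x 0 := by field_simp; linarith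
    have e3 : p₃ = (x 2 * p₁ + x 1 * p₂) / x 0 := by field_simp; linarith
    have e4 : p₄ = x 2 * p₂ / x 0 := by field_simp; linarith
    have e5 : p₅ = (x 2 * p₃ - x 1 * p₄) / x 0 := by field_simp; linarith
    apply key (p₁ / (2 * x 0 ^ 2)) <;> (try simp only [e2, e3, e4, e5]) <;> field_simp <;> ring

theorem omega_injective : Function.Injective omega := by
  rw [← LinearMap.ker_eq_bot, LinearMap.ker_eq_bot']
  intro x hx
  have h : ∀ φ : V →ₗ[ℝ] ℝ, contract φ (omega x) = 0 := by simp [hx]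
  have ha := h (formEval ![1, 0, 0] ![1, 0, 0])
  have hb := h (formEval ![0, 0, 1] ![0, 0, 1])
  rw [contract_omega] at ha hb
  have hea := sigma_comb_eq_zero ha
  have heb := sigma_comb_eq_zero hb
  simp [formEval_eq, σ₁, σ₂, σ₃, σ₄, σ₅] at hea heb
  ext i
  fin_cases i <;> simp [hea, heb]

/-! ### Linear maps preserving `W` are congruences by similitudes of `J` -/

/-- The symmetric matrix whose multiples are orthogonal to `V` for the trace form. -/
def J : Matrix (Fin 3) (Fin 3) ℝ := !![0, 0, -1; 0, 1, 0; -1, 0, 0]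

theorem J_mul_J : J * J = 1 := by
  ext i j
  fin_cases i <;> fin_cases j <;> simp [J, Matrix.mul_apply, Fin.sum_univ_three]

theorem J_transpose : Jᵀ = J := by
  ext i j
  fin_cases i <;> fin_cases j <;> simp [J]

theorem formEval_mulVec (γ : Matrix (Fin 3) (Fin 3) ℝ) (x y : Fin 3 → ℝ) (v : V) :
    formEval (γ *ᵥ x) (γ *ᵥ y) v = x ⬝ᵥ ((γᵀ * v.1 * γ) *ᵥ y) := by
  rw [formEval_apply, ← mulVec_mulVec, ← mulVec_mulVec, dotProduct_mulVec x, vecMul_transpose]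

/-- The polynomials `x₀²` and `x₂²` are coprime, so each divides the quadratic form on its own side
and the two quotients are the same constant. The coefficients are compared at eleven test points. -/
theorem quadForm_ratio {c d : Matrix (Fin 3) (Fin 3) ℝ}
    (h : ∀ x : Fin 3 → ℝ, (x ⬝ᵥ (c *ᵥ x)) * x 2 ^ 2 = (x ⬝ᵥ (d *ᵥ x)) * x 0 ^ 2) :
    (∀ x : Fin 3 → ℝ, x ⬝ᵥ (c *ᵥ x) = c 0 0 * x 0 ^ 2) ∧
      ∀ x : Fin 3 → ℝ, x ⬝ᵥ (d *ᵥ x) = c 0 0 * x 2 ^ 2 := by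
  simp only [dotProduct, mulVec, Fin.sum_univ_three] at h ⊢
  have h1 := h ![1, 0, 0]
  have h2 := h ![1, 1, 0]
  have h3 := h ![1, -1, 0]
  have h4 := h ![0, 0, 1]
  have h5 := h ![0, 1, 1]
  have h6 := h ![0, -1, 1]
  have h7 := h ![1, 0, 1]
  have h8 := h ![1, 0, -1]
  have h9 := h ![2, 0, 1]
  have h10 := h ![1, 1, 1]
  have h11 := h ![2, 1, 1]
  clear h
  simp at h1 h2 h3 h4 h5 h6 h7 h8 h9 h10 h11
  have e1 : c 1 1 = 0 := by linarith
  have e2 : c 2 2 = 0 := by linarith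
  have e3 : c 1 2 = - c 2 1 := by linarith
  have e4 : d 0 0 = 0 := by linarith
  have e5 : d 1 1 = 0 := by linarith
  have e6 : d 0 1 = - d 1 0 := by linarith
  have e7 : c 0 2 = - c 2 0 := by linarith
  have e8 : d 0 2 = - d 2 0 := by linarith
  have e9 : d 2 2 = c 0 0 := by linarith
  have e10 : c 0 1 = - c 1 0 := by linarith
  have e11 : d 1 2 = - d 2 1 := by linarith
  constructor <;> intro x <;> simp only [e1, e2, e3, e4, e5, e6, e7, e8, e9, e10, e11] <;> ring

/-- A quadratic map pointwise proportional to `x ↦ formEval x x` is proportional to it. -/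
theorem formEval_constant_ratio {α : V →ₗ[ℝ] V} {γ : Matrix (Fin 3) (Fin 3) ℝ}
    (h : ∀ x, x ≠ 0 → ∃ r : ℝ, formEval (γ *ᵥ x) (γ *ᵥ x) ∘ₗ α = r • formEval x x) :
    ∃ μ : ℝ, ∀ v : V, γᵀ * (α v).1 * γ = μ • v.1 := by
  have h' : ∀ x : Fin 3 → ℝ, ∃ r : ℝ, ∀ v,
      x ⬝ᵥ ((γᵀ * (α v).1 * γ) *ᵥ x) = r * formEval x x v := by
    intro x
    by_cases hx : x = 0
    · exact ⟨0, by simp [hx]⟩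
    obtain ⟨r, hr⟩ := h x hx
    refine ⟨r, fun v => ?_⟩
    rw [← formEval_mulVec]
    exact LinearMap.congr_fun hr v
  choose r hr using h'
  obtain ⟨h₁, h₅⟩ := quadForm_ratio (c := γᵀ * (α σ₁).1 * γ) (d := γᵀ * (α σ₅).1 * γ) (by
    intro x
    rw [hr, hr, formEval_σ₁, formEval_σ₅]
    ring)
  set A := (γᵀ * (α σ₁).1 * γ) 0 0 with hA
  -- The forms of `σ₁` and `σ₅` are `2x₀²` and `2x₂²`, so together they pin down the ratio
  -- everywhere except on the line `x₀ = x₂ = 0`.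
  have hrA : ∀ x : Fin 3 → ℝ, (x 0 ≠ 0 ∨ x 2 ≠ 0) → r x = A / 2 := by
    rintro x (hx | hx)
    · have := h₁ x
      rw [hr, formEval_σ₁] at this
      field_simp at this
      linarith
    · have := h₅ x
      rw [hr, formEval_σ₅] at this
      field_simp at this
      linarith
  refine ⟨A / 2, fun v => ?_⟩
  set c := γᵀ * (α v).1 * γ with hc
  have hsymm : ∀ i j, c i j = c j i := by
    have : cᵀ = c := by
      rw [hc, transpose_mul, transpose_mul, transpose_transpose, (α v).2.1, Matrix.mul_assoc]
    intro i j
    conv_lhs => rw [← this]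
    rfl
  have hx : ∀ x : Fin 3 → ℝ, (x 0 ≠ 0 ∨ x 2 ≠ 0) →
      x ⬝ᵥ (c *ᵥ x) = A / 2 * formEval x x v := fun x hx => by rw [hr, hrA x hx]
  simp only [dotProduct, mulVec, Fin.sum_univ_three, formEval_eq] at hx
  -- Six points off the exceptional line determine a symmetric matrix.
  have h1 := hx ![1, 0, 0] (by simp)
  have h2 := hx ![1, 1, 0] (by simp)
  have h3 := hx ![1, -1, 0] (by simp)
  have h4 := hx ![0, 0, 1] (by simp)
  have h5 := hx ![0, 1, 1] (by simp)
  have h6 := hx ![1, 0, 1] (by simp)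
  simp [hsymm 1 0, hsymm 2 0, hsymm 2 1] at h1 h2 h3 h4 h5 h6
  ext i j
  fin_cases i <;> fin_cases j <;>
    simp [hsymm 1 0, hsymm 2 0, hsymm 2 1, V_symm v 1 0, V_symm v 2 0, V_symm v 2 1, V_middle] <;>
    linarith

/-- A linear automorphism of `V` whose second exterior power preserves `W` is a congruence. -/
theorem exists_congruence (α : V ≃ₗ[ℝ] V)
    (hα : ∀ ω ∈ W, exteriorPower.map 2 α.toLinearMap ω ∈ W) :
    ∃ (γ : Matrix (Fin 3) (Fin 3) ℝ) (μ : ℝ), IsUnit γ.det ∧ μ ≠ 0 ∧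
      ∀ v, γᵀ * (α v).1 * γ = μ • v.1 := by
  let e : (Fin 3 → ℝ) ≃ₗ[ℝ] LinearMap.range omega := LinearEquiv.ofInjective omega omega_injective
  -- `g` is the action of `⋀² α` on `W`, read in the coordinates given by `omega`; its matrix is the
  -- required `γ`.
  let g : (Fin 3 → ℝ) →ₗ[ℝ] (Fin 3 → ℝ) := e.symm.toLinearMap ∘ₗ
    LinearMap.codRestrict (LinearMap.range omega)
      (exteriorPower.map 2 α.toLinearMap ∘ₗ omega) (fun x => by
        have hx : omega x ∈ W := by rw [← range_omega]; exact ⟨x, rfl⟩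
        rw [range_omega]
        exact hα _ hx)
  have hg : ∀ x, omega (g x) = exteriorPower.map 2 α.toLinearMap (omega x) := by
    intro x
    have : e (g x) = ⟨exteriorPower.map 2 α.toLinearMap (omega x), _⟩ :=
      e.apply_symm_apply _
    exact congrArg Subtype.val this
  have hginj : Function.Injective g := by
    intro x y hxy
    have hi : Function.Injective (exteriorPower.map 2 α.toLinearMap) :=
      exteriorPower.map_injective α.symm.toLinearMap (by ext; simp)
    apply omega_injective
    apply hi
    rw [← hg, ← hg, hxy]
  set γ := LinearMap.toMatrix' g with hγ
  have hγg : ∀ x, γ *ᵥ x = g x := fun x => by rw [hγ, LinearMap.toMatrix'_mulVec]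
  have hunit : IsUnit γ.det := by
    rw [← isUnit_iff_isUnit_det, ← mulVec_injective_iff_isUnit]
    intro x y hxy
    simp only [hγg] at hxy
    exact hginj hxy
  -- Evaluation at `γx` kills `omega (γx) = ⋀² α (omega x)`. Hence its pull-back by `α` kills `omega
  -- x` and is a multiple of evaluation at `x`.
  obtain ⟨μ, hμ⟩ := formEval_constant_ratio (α := α.toLinearMap) (γ := γ) (by
    intro x hx
    apply exists_eq_smul_formEval hx
    apply α.injective
    have := contract_formEval_omega (γ *ᵥ x)
    rw [hγg, hg, contract_map] at this
    rw [map_zero, hγg]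
    exact this)
  refine ⟨γ, μ, hunit, ?_, hμ⟩
  rintro rfl
  have h0 : ∀ v : V, (α v).1 = 0 := by
    intro v
    have := hμ v
    rw [zero_smul] at this
    have h1 : γ⁻¹ᵀ * (γᵀ * (α v).1 * γ) * γ⁻¹ = (α v).1 := by
      rw [Matrix.mul_assoc, Matrix.mul_assoc, Matrix.mul_nonsing_inv _ hunit, Matrix.mul_one,
        ← Matrix.mul_assoc, ← transpose_mul, Matrix.mul_nonsing_inv _ hunit, transpose_one,
        Matrix.one_mul]
    rw [← h1]
    erw [this]
    simp
  have h1 := h0 (α.symm σ₁)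
  rw [α.apply_symm_apply] at h1
  have := congrFun (congrFun h1 0) 0
  simp [σ₁] at this

/-- The congruence associated with an automorphism preserves `J` up to scale. -/
theorem congruence_preserves_J {α : V ≃ₗ[ℝ] V} {γ : Matrix (Fin 3) (Fin 3) ℝ} {μ : ℝ}
    (hγ : IsUnit γ.det) (h : ∀ v, γᵀ * (α v).1 * γ = μ • v.1) :
    ∃ l : ℝ, l ≠ 0 ∧ γ * J * γᵀ = l • J := by
  have htr : ∀ v : V, trace (J * v.1) = 0 := by
    intro v
    simp only [trace, diag, Fin.sum_univ_three, Matrix.mul_apply]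
    simp [J, V_symm v 2 0, V_middle v]
    ring
  set S := γ * J * γᵀ with hS
  -- By cyclicity, `tr(γJγᵀv) = tr(Jγᵀvγ) = μ tr(J α⁻¹v)`, which is zero because `J` is
  -- trace-orthogonal to `V`.
  have hS0 : ∀ v : V, trace (S * v.1) = 0 := by
    intro v
    have h1 := h (α.symm v)
    rw [α.apply_symm_apply] at h1
    rw [hS, Matrix.mul_assoc, Matrix.mul_assoc, trace_mul_comm, Matrix.mul_assoc,
      Matrix.mul_assoc, ← Matrix.mul_assoc γᵀ, h1, mul_smul_comm, trace_smul, htr, smul_zero]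
  have hsymm : ∀ i j, S i j = S j i := by
    have : Sᵀ = S := by
      rw [hS, transpose_mul, transpose_mul, transpose_transpose, J_transpose, Matrix.mul_assoc]
    intro i j
    conv_lhs => rw [← this]
    rfl
  have h1 := hS0 σ₁
  have h2 := hS0 σ₂
  have h3 := hS0 σ₃
  have h4 := hS0 σ₄
  have h5 := hS0 σ₅
  simp [σ₁, σ₂, σ₃, σ₄, σ₅, trace, Fin.sum_univ_three, Matrix.mul_apply, hsymm 1 0, hsymm 2 0,
    hsymm 2 1] at h1 h2 h3 h4 h5
  have hSJ : S = S 1 1 • J := by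
    ext i j
    fin_cases i <;> fin_cases j <;> simp [J, hsymm 1 0, hsymm 2 0, hsymm 2 1] <;> linarith
  refine ⟨S 1 1, fun h0 => ?_, hSJ⟩
  rw [h0, zero_smul] at hSJ
  have := congrArg det hSJ
  rw [hS, det_mul, det_mul, det_transpose] at this
  have hJ : J.det = -1 := by simp [J, det_fin_three]
  rw [hJ, det_zero] at this
  simp [hγ.ne_zero] at this

/-! ### Elements of `V'` as `J`-harmonic cubic tensors -/

/-- An entry of the matrix, as a linear form on `V`. -/
def entry (i j : Fin 3) : V →ₗ[ℝ] ℝ where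
  toFun v := v.1 i j
  map_add' _ _ := rfl
  map_smul' _ _ := rfl

theorem entry_apply (i j : Fin 3) (v : V) : entry i j v = v.1 i j := rfl

/-- The alternating form `φ ∧ ψ`. -/
noncomputable def minor (φ ψ : V →ₗ[ℝ] ℝ) : ⋀[ℝ]^2 V →ₗ[ℝ] ℝ :=
  wedgeLift (LinearMap.mk₂ ℝ (fun v w => φ v * ψ w - ψ v * φ w)
    (by intros; simp only [map_add]; ring) (by intros; simp only [map_smul, smul_eq_mul]; ring)
    (by intros; simp only [map_add]; ring) (by intros; simp only [map_smul, smul_eq_mul]; ring))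
    (by intro v; simp [mul_comm])

theorem minor_wedge (φ ψ : V →ₗ[ℝ] ℝ) (v w : V) :
    minor φ ψ (wedge v w) = φ v * ψ w - ψ v * φ w := by
  simp [minor, wedgeLift_wedge]

theorem minor_map (φ ψ : V →ₗ[ℝ] ℝ) (α : V →ₗ[ℝ] V) (ω : ⋀[ℝ]^2 V) :
    minor φ ψ (exteriorPower.map 2 α ω) = minor (φ ∘ₗ α) (ψ ∘ₗ α) ω := by
  have : minor φ ψ ∘ₗ exteriorPower.map 2 α = minor (φ ∘ₗ α) (ψ ∘ₗ α) := by
    apply linearMap_ext_wedge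
    intro v w
    simp [map_wedge, minor_wedge]
  exact LinearMap.congr_fun this ω

/-- Seven linear forms on `⋀² V` which vanish on `W`. -/
noncomputable def wedgeCoeffs : ⋀[ℝ]^2 V →ₗ[ℝ] (Fin 7 → ℝ) :=
  LinearMap.pi ![(1 / 2 : ℝ) • minor (entry 0 0) (entry 0 1),
    (1 / 2 : ℝ) • minor (entry 0 0) (entry 0 2),
    (1 / 2 : ℝ) • minor (entry 0 0) (entry 1 2) + minor (entry 0 1) (entry 0 2),
    (1 / 4 : ℝ) • minor (entry 0 0) (entry 2 2) + minor (entry 0 1) (entry 1 2),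
    (1 / 2 : ℝ) • minor (entry 0 1) (entry 2 2) + minor (entry 0 2) (entry 1 2),
    (1 / 2 : ℝ) • minor (entry 0 2) (entry 2 2),
    (1 / 2 : ℝ) • minor (entry 1 2) (entry 2 2)]

theorem wedgeCoeffs_wedge (v w : V) : wedgeCoeffs (wedge v w) =
    ![(v.1 0 0 * w.1 0 1 - v.1 0 1 * w.1 0 0) / 2,
      (v.1 0 0 * w.1 0 2 - v.1 0 2 * w.1 0 0) / 2,
      (v.1 0 0 * w.1 1 2 - v.1 1 2 * w.1 0 0) / 2 + (v.1 0 1 * w.1 0 2 - v.1 0 2 * w.1 0 1),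
      (v.1 0 0 * w.1 2 2 - v.1 2 2 * w.1 0 0) / 4 + (v.1 0 1 * w.1 1 2 - v.1 1 2 * w.1 0 1),
      (v.1 0 1 * w.1 2 2 - v.1 2 2 * w.1 0 1) / 2 + (v.1 0 2 * w.1 1 2 - v.1 1 2 * w.1 0 2),
      (v.1 0 2 * w.1 2 2 - v.1 2 2 * w.1 0 2) / 2,
      (v.1 1 2 * w.1 2 2 - v.1 2 2 * w.1 1 2) / 2] := by
  ext i
  fin_cases i <;> simp [wedgeCoeffs, minor_wedge, entry_apply] <;> ring

theorem W_le_ker_wedgeCoeffs : W ≤ LinearMap.ker wedgeCoeffs := by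
  refine Submodule.span_le.2 ?_
  rintro _ (rfl | rfl | rfl) <;>
  · simp only [SetLike.mem_coe, LinearMap.mem_ker, map_sub, wedgeCoeffs_wedge]
    ext i
    fin_cases i <;> simp [σ₁, σ₂, σ₃, σ₄, σ₅]
    try norm_num

/-- The linear coordinates on `V'`. -/
noncomputable def coeffs : V' →ₗ[ℝ] (Fin 7 → ℝ) := W.liftQ wedgeCoeffs W_le_ker_wedgeCoeffs

theorem coeffs_mkQ (ω : ⋀[ℝ]^2 V) : coeffs (W.mkQ ω) = wedgeCoeffs ω := rfl

/-- The `J`-harmonic cubic tensor on `ℝ³` with the given coordinates. -/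
def tensor (c : Fin 7 → ℝ) : Fin 3 → Matrix (Fin 3) (Fin 3) ℝ :=
  ![!![5 * c 0, 5 * c 1, c 2; 5 * c 1, 2 * c 2, c 3; c 2, c 3, c 4],
    !![5 * c 1, 2 * c 2, c 3; 2 * c 2, 2 * c 3, 2 * c 4; c 3, 2 * c 4, 5 * c 5],
    !![c 2, c 3, c 4; c 3, 2 * c 4, 5 * c 5; c 4, 5 * c 5, 5 * c 6]]

/-- A tensor on `ℝ³` which is symmetric and has vanishing trace with respect to `J`. -/
structure IsHarmonic (F : Fin 3 → Matrix (Fin 3) (Fin 3) ℝ) : Prop where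
  symm : ∀ k i j, F k i j = F k j i
  symm' : ∀ k i j, F k i j = F i k j
  trace_eq : ∀ k, trace (J * F k) = 0

/-- The cubic form of a tensor. -/
def cubic (F : Fin 3 → Matrix (Fin 3) (Fin 3) ℝ) (x : Fin 3 → ℝ) : ℝ :=
  ∑ k, x k * (x ⬝ᵥ (F k *ᵥ x))

theorem trace_J_mul (M : Matrix (Fin 3) (Fin 3) ℝ) : trace (J * M) = M 1 1 - M 2 0 - M 0 2 := by
  simp only [trace, diag, Fin.sum_univ_three, Matrix.mul_apply]
  simp [J]
  ring

theorem isHarmonic_tensor (c : Fin 7 → ℝ) : IsHarmonic (tensor c) where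
  symm k i j := by fin_cases k <;> fin_cases i <;> fin_cases j <;> simp [tensor]
  symm' k i j := by fin_cases k <;> fin_cases i <;> fin_cases j <;> simp [tensor]
  trace_eq k := by
    rw [trace_J_mul]
    fin_cases k <;> simp [tensor] <;> ring

theorem tensor_smul (r : ℝ) (c : Fin 7 → ℝ) : tensor (r • c) = r • tensor c := by
  ext k i j
  fin_cases k <;> fin_cases i <;> fin_cases j <;> simp [tensor] <;> ring

theorem tensor_add (c d : Fin 7 → ℝ) : tensor (c + d) = tensor c + tensor d := by
  ext k i j
  fin_cases k <;> fin_cases i <;> fin_cases j <;> simp [tensor] <;> ring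

theorem IsHarmonic.sub {F G : Fin 3 → Matrix (Fin 3) (Fin 3) ℝ} (hF : IsHarmonic F)
    (hG : IsHarmonic G) : IsHarmonic (F - G) where
  symm k i j := by simp [hF.symm k i j, hG.symm k i j]
  symm' k i j := by simp [hF.symm' k i j, hG.symm' k i j]
  trace_eq k := by simp [Matrix.mul_sub, hF.trace_eq, hG.trace_eq]

theorem IsHarmonic.smul {F : Fin 3 → Matrix (Fin 3) (Fin 3) ℝ} (hF : IsHarmonic F) (r : ℝ) :
    IsHarmonic (r • F) where
  symm k i j := by simp [hF.symm k i j]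
  symm' k i j := by simp [hF.symm' k i j]
  trace_eq k := by simp [hF.trace_eq]

/-- A harmonic tensor is determined by the values of its cubic form on the null cone of `J`. -/
theorem IsHarmonic.eq_zero {F : Fin 3 → Matrix (Fin 3) (Fin 3) ℝ} (hF : IsHarmonic F)
    (h : ∀ x : Fin 3 → ℝ, x 1 ^ 2 = 2 * x 0 * x 2 → cubic F x = 0) : F = 0 := by
  -- This parametrizes half of the null cone by a square, so the restricted cubic becomes a binary
  -- sextic in `s, t`.
  have hst : ∀ s t : ℝ, cubic F ![2 * s ^ 2, 2 * s * t, t ^ 2] = 0 := by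
    intro s t
    apply h
    simp
    ring
  have t0 := hF.trace_eq 0
  have t1 := hF.trace_eq 1
  have t2 := hF.trace_eq 2
  rw [trace_J_mul] at t0 t1 t2
  have a010 : F 0 1 0 = F 0 0 1 := hF.symm 0 1 0
  have a020 : F 0 2 0 = F 0 0 2 := hF.symm 0 2 0
  have a021 : F 0 2 1 = F 0 1 2 := hF.symm 0 2 1
  have a100 : F 1 0 0 = F 0 0 1 := (hF.symm' 1 0 0).trans a010
  have a101 : F 1 0 1 = F 0 1 1 := hF.symm' 1 0 1
  have a102 : F 1 0 2 = F 0 1 2 := hF.symm' 1 0 2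
  have a110 : F 1 1 0 = F 0 1 1 := (hF.symm 1 1 0).trans a101
  have a120 : F 1 2 0 = F 0 1 2 := (hF.symm 1 2 0).trans a102
  have a121 : F 1 2 1 = F 1 1 2 := hF.symm 1 2 1
  have a200 : F 2 0 0 = F 0 0 2 := (hF.symm' 2 0 0).trans a020
  have a201 : F 2 0 1 = F 0 1 2 := (hF.symm' 2 0 1).trans a021
  have a202 : F 2 0 2 = F 0 2 2 := hF.symm' 2 0 2
  have a210 : F 2 1 0 = F 0 1 2 := (hF.symm 2 1 0).trans a201
  have a211 : F 2 1 1 = F 1 1 2 := (hF.symm' 2 1 1).trans a121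
  have a212 : F 2 1 2 = F 1 2 2 := hF.symm' 2 1 2
  have a220 : F 2 2 0 = F 0 2 2 := (hF.symm 2 2 0).trans a202
  have a221 : F 2 2 1 = F 1 2 2 := (hF.symm 2 2 1).trans a212
  simp only [cubic, dotProduct, mulVec, Fin.sum_univ_three, a010, a020, a021, a100, a101, a102,
    a110, a120, a121, a200, a201, a202, a210, a211, a212, a220, a221] at hst t0 t1 t2
  -- Seven projectively distinct points annihilate the sextic. With the three trace equations this
  -- gives ten conditions on the ten coefficients of a ternary cubic.
  have h0 := hst 1 0
  have h1 := hst 0 1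
  have h2 := hst 1 1
  have h3 := hst 1 (-1)
  have h4 := hst 1 2
  have h5 := hst 1 (-2)
  have h6 := hst 2 1
  clear hst
  simp at h0 h1 h2 h3 h4 h5 h6
  have b000 : F 0 0 0 = 0 := by linarith
  have b222 : F 2 2 2 = 0 := by linarith
  have b001 : F 0 0 1 = 0 := by linarith
  have b122 : F 1 2 2 = 0 := by linarith
  have b002 : F 0 0 2 = 0 := by linarith
  have b022 : F 0 2 2 = 0 := by linarith
  have b012 : F 0 1 2 = 0 := by linarith
  have b011 : F 0 1 1 = 0 := by linarith
  have b112 : F 1 1 2 = 0 := by linarith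
  have b111 : F 1 1 1 = 0 := by linarith
  ext k i j
  fin_cases k <;> fin_cases i <;> fin_cases j <;> simp [*]

/-- The pull-back of a cubic tensor. -/
def pull (γ : Matrix (Fin 3) (Fin 3) ℝ) (F : Fin 3 → Matrix (Fin 3) (Fin 3) ℝ) :
    Fin 3 → Matrix (Fin 3) (Fin 3) ℝ :=
  fun k => ∑ m, γ m k • (γᵀ * F m * γ)

theorem pull_apply (γ : Matrix (Fin 3) (Fin 3) ℝ) (F : Fin 3 → Matrix (Fin 3) (Fin 3) ℝ)
    (k i j : Fin 3) : pull γ F k i j = ∑ m, ∑ a, ∑ b, γ m k * γ a i * γ b j * F m a b := by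
  simp only [pull, Matrix.sum_apply, Matrix.smul_apply, Matrix.mul_apply, smul_eq_mul,
    transpose_apply, Finset.mul_sum, Finset.sum_mul]
  refine Finset.sum_congr rfl fun m _ => ?_
  rw [Finset.sum_comm]
  refine Finset.sum_congr rfl fun a _ => Finset.sum_congr rfl fun b _ => ?_
  ring

/-- The trace condition survives because `tr(Jγᵀ F_m γ) = tr(γJγᵀ F_m) = l tr(J F_m)`. -/
theorem IsHarmonic.pull {F : Fin 3 → Matrix (Fin 3) (Fin 3) ℝ} (hF : IsHarmonic F)
    {γ : Matrix (Fin 3) (Fin 3) ℝ} {l : ℝ} (hγ : γ * J * γᵀ = l • J) : IsHarmonic (pull γ F) where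
  symm k i j := by
    rw [pull_apply, pull_apply]
    refine Finset.sum_congr rfl fun m _ => ?_
    rw [Finset.sum_comm]
    refine Finset.sum_congr rfl fun a _ => Finset.sum_congr rfl fun b _ => ?_
    rw [hF.symm]
    ring
  symm' k i j := by
    rw [pull_apply, pull_apply, Finset.sum_comm]
    refine Finset.sum_congr rfl fun m _ => Finset.sum_congr rfl fun a _ =>
      Finset.sum_congr rfl fun b _ => ?_
    rw [hF.symm']
    ring
  trace_eq k := by
    simp only [SmallAut.pull, Matrix.mul_sum, mul_smul_comm, trace_sum, trace_smul]
    refine Finset.sum_eq_zero fun m _ => ?_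
    rw [← Matrix.mul_assoc, trace_mul_comm, ← Matrix.mul_assoc, ← Matrix.mul_assoc, hγ,
      smul_mul_assoc, trace_smul, hF.trace_eq, smul_zero, smul_zero]

theorem cubic_pull (γ : Matrix (Fin 3) (Fin 3) ℝ) (F : Fin 3 → Matrix (Fin 3) (Fin 3) ℝ)
    (x : Fin 3 → ℝ) : cubic (pull γ F) x = cubic F (γ *ᵥ x) := by
  have h : ∀ m, (γ *ᵥ x) ⬝ᵥ (F m *ᵥ (γ *ᵥ x)) = x ⬝ᵥ ((γᵀ * F m * γ) *ᵥ x) := by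
    intro m
    rw [← mulVec_mulVec, ← mulVec_mulVec, dotProduct_mulVec x, vecMul_transpose]
  simp only [cubic, h, pull, sum_mulVec, smul_mulVec, dotProduct_sum, dotProduct_smul, smul_eq_mul]
  simp only [mulVec, dotProduct, Fin.sum_univ_three]
  ring

/-! ### Equivariance of the harmonic tensor -/

/-- On the null cone, the cubic form of `tensor` is given by a `2 × 2` minor. -/
theorem minor_formEval_wedge {x y : Fin 3 → ℝ} (hx : x 1 ^ 2 = 2 * x 0 * x 2)
    (hxy : x 1 * y 1 = x 0 * y 2 + x 2 * y 0) (v w : V) (i : Fin 3) :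
    5 * minor (formEval x x) (formEval x y) (wedge v w) * x i =
      -2 * cubic (tensor (wedgeCoeffs (wedge v w))) x * (J *ᵥ (x ⨯₃ y)) i := by
  obtain ⟨a, b, c, rfl⟩ : ∃ a b c, x = ![a, b, c] :=
    ⟨x 0, x 1, x 2, by ext i; fin_cases i <;> rfl⟩
  obtain ⟨d, e, f, rfl⟩ : ∃ d e f, y = ![d, e, f] :=
    ⟨y 0, y 1, y 2, by ext i; fin_cases i <;> rfl⟩
  have hJ : J *ᵥ (![a, b, c] ⨯₃ ![d, e, f]) = ![b * d - a * e, c * d - a * f, c * e - b * f] := by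
    rw [cross_apply]
    ext i
    fin_cases i <;> simp [J]
  rw [hJ]
  simp only [minor_wedge, wedgeCoeffs_wedge, formEval_eq, cubic, tensor, dotProduct, mulVec,
    Fin.sum_univ_three]
  simp only [Matrix.cons_val, Matrix.of_apply] at hx hxy ⊢
  -- Off `c = 0` the two constraints are solved for `a` and `d`. On it, `b = 0` and `a * f = 0`.
  by_cases hc : c = 0
  · subst hc
    have hb : b = 0 := by simpa using hx
    subst hb
    have haf : a * f = 0 := by linarith
    rcases mul_eq_zero.1 haf with rfl | rfl <;> fin_cases i <;> simp only [Matrix.cons_val,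
      Fin.zero_eta, Fin.mk_one, Fin.reduceFinMk] <;> ring
  · obtain rfl : a = b ^ 2 / (2 * c) := by field_simp; linarith
    obtain rfl : d = (b * e - b ^ 2 / (2 * c) * f) / c := by
      field_simp at hxy ⊢; linarith
    fin_cases i <;> simp only [Matrix.cons_val, Fin.zero_eta, Fin.mk_one,
      Fin.reduceFinMk] <;> field_simp <;> ring

/-- For `x` null and `y` tangent to the cone at `x`, the vector `J(x × y)` is parallel to `x`;
comparing coordinates avoids naming the factor. The left side transforms transparently under a
congruence, so the cubic form can be followed through it. -/
theorem minor_formEval {x y : Fin 3 → ℝ} (hx : x 1 ^ 2 = 2 * x 0 * x 2)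
    (hxy : x 1 * y 1 = x 0 * y 2 + x 2 * y 0) (ω : ⋀[ℝ]^2 V) (i : Fin 3) :
    5 * minor (formEval x x) (formEval x y) ω * x i =
      -2 * cubic (tensor (wedgeCoeffs ω)) x * (J *ᵥ (x ⨯₃ y)) i := by
  let T : (Fin 7 → ℝ) →ₗ[ℝ] ℝ :=
    { toFun := fun c => cubic (tensor c) x
      map_add' := fun c d => by
        simp [tensor_add, cubic, add_mulVec, mul_add, Finset.sum_add_distrib]
      map_smul' := fun r c => by
        simp [tensor_smul, cubic, smul_mulVec, Finset.mul_sum, mul_left_comm] }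
  have h : (5 * x i) • minor (formEval x x) (formEval x y) =
      (-2 * (J *ᵥ (x ⨯₃ y)) i) • (T ∘ₗ wedgeCoeffs) := by
    apply linearMap_ext_wedge
    intro v w
    have := minor_formEval_wedge hx hxy v w i
    simp only [LinearMap.smul_apply, smul_eq_mul, LinearMap.comp_apply]
    change _ = _ * cubic (tensor (wedgeCoeffs (wedge v w))) x
    linarith
  have h' := LinearMap.congr_fun h ω
  simp only [LinearMap.smul_apply, smul_eq_mul, LinearMap.comp_apply] at h'
  change _ = _ * cubic (tensor (wedgeCoeffs ω)) x at h'
  linarith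

/-- Paired with any `z`, both sides are the determinant of `γx, γy, γz`. -/
theorem transpose_mulVec_cross (γ : Matrix (Fin 3) (Fin 3) ℝ) (x y : Fin 3 → ℝ) :
    γᵀ *ᵥ ((γ *ᵥ x) ⨯₃ (γ *ᵥ y)) = γ.det • (x ⨯₃ y) := by
  simp only [cross_apply, det_fin_three]
  ext i
  fin_cases i <;> simp [mulVec, dotProduct, Fin.sum_univ_three] <;> ring

/-- As `J² = 1`, the hypothesis exhibits `l⁻¹ J γᵀ J` as a right inverse of `γ`; it is then also a
left inverse. -/
theorem preserves_J_transpose {γ : Matrix (Fin 3) (Fin 3) ℝ} {l : ℝ} (hl : l ≠ 0)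
    (hJ : γ * J * γᵀ = l • J) : γᵀ * J * γ = l • J := by
  have h1 : γ * (l⁻¹ • (J * γᵀ * J)) = 1 := by
    rw [mul_smul_comm, ← Matrix.mul_assoc, ← Matrix.mul_assoc, hJ, smul_mul_assoc, J_mul_J,
      smul_smul, inv_mul_cancel₀ hl, one_smul]
  have h2 := mul_eq_one_comm.1 h1
  calc γᵀ * J * γ = (l • J) * ((l⁻¹ • (J * γᵀ * J)) * γ) := by
        simp only [smul_mul_assoc, mul_smul_comm, smul_smul, inv_mul_cancel₀ hl, one_smul,
          ← Matrix.mul_assoc, J_mul_J, Matrix.one_mul]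
    _ = l • J := by rw [h2, Matrix.mul_one]

theorem dotProduct_J_mulVec (x y : Fin 3 → ℝ) :
    x ⬝ᵥ (J *ᵥ y) = x 1 * y 1 - x 0 * y 2 - x 2 * y 0 := by
  simp [J, dotProduct, mulVec, Fin.sum_univ_three]
  ring

theorem dotProduct_J_of_preserves {γ : Matrix (Fin 3) (Fin 3) ℝ} {l : ℝ}
    (h : γᵀ * J * γ = l • J) (x y : Fin 3 → ℝ) :
    (γ *ᵥ x) ⬝ᵥ (J *ᵥ (γ *ᵥ y)) = l * (x ⬝ᵥ (J *ᵥ y)) := by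
  rw [← smul_eq_mul, ← dotProduct_smul, ← smul_mulVec, ← h, ← mulVec_mulVec, ← mulVec_mulVec,
    dotProduct_mulVec x, vecMul_transpose]

/-- The harmonic tensor of an element of `⋀² V` transforms equivariantly. -/
theorem pull_tensor_wedgeCoeffs {α : V →ₗ[ℝ] V} {γ : Matrix (Fin 3) (Fin 3) ℝ} {μ l : ℝ}
    (hγ : IsUnit γ.det) (hl : l ≠ 0) (hJ : γ * J * γᵀ = l • J)
    (h : ∀ v, γᵀ * (α v).1 * γ = μ • v.1) (ω : ⋀[ℝ]^2 V) :
    pull γ (tensor (wedgeCoeffs (exteriorPower.map 2 α ω))) =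
      (l * μ ^ 2 / γ.det) • tensor (wedgeCoeffs ω) := by
  have hJ' := preserves_J_transpose hl hJ
  have hform : ∀ x y, formEval (γ *ᵥ x) (γ *ᵥ y) ∘ₗ α = μ • formEval x y := by
    intro x y
    ext v
    rw [LinearMap.comp_apply, formEval_mulVec, h, smul_mulVec, dotProduct_smul]
    rfl
  have hminor : ∀ x y, minor (formEval (γ *ᵥ x) (γ *ᵥ x)) (formEval (γ *ᵥ x) (γ *ᵥ y))
      (exteriorPower.map 2 α ω) = μ ^ 2 * minor (formEval x x) (formEval x y) ω := by
    intro x y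
    rw [minor_map, hform, hform]
    have : minor (μ • formEval x x) (μ • formEval x y) =
        μ ^ 2 • minor (formEval x x) (formEval x y) := by
      apply linearMap_ext_wedge
      intro v w
      simp only [minor_wedge, LinearMap.smul_apply, smul_eq_mul]
      ring
    rw [this]
    rfl
  have hcross : ∀ x y, l • (J *ᵥ ((γ *ᵥ x) ⨯₃ (γ *ᵥ y))) =
      γ.det • (γ *ᵥ (J *ᵥ (x ⨯₃ y))) := by
    intro x y
    rw [← smul_mulVec, ← hJ, ← mulVec_mulVec, transpose_mulVec_cross, mulVec_smul, mulVec_mulVec]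
  have key : ∀ x y : Fin 3 → ℝ, x 1 ^ 2 = 2 * x 0 * x 2 →
      x 1 * y 1 = x 0 * y 2 + x 2 * y 0 → x ⨯₃ y ≠ 0 →
      cubic (tensor (wedgeCoeffs (exteriorPower.map 2 α ω))) (γ *ᵥ x) * γ.det =
        l * μ ^ 2 * cubic (tensor (wedgeCoeffs ω)) x := by
    intro x y hx hxy hne
    have hx0 : x ⬝ᵥ (J *ᵥ x) = 0 := by rw [dotProduct_J_mulVec]; linarith
    have hy0 : x ⬝ᵥ (J *ᵥ y) = 0 := by rw [dotProduct_J_mulVec]; linarith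
    have hx1 := dotProduct_J_of_preserves hJ' x x
    have hy1 := dotProduct_J_of_preserves hJ' x y
    rw [hx0, mul_zero, dotProduct_J_mulVec] at hx1
    rw [hy0, mul_zero, dotProduct_J_mulVec] at hy1
    set z := J *ᵥ (x ⨯₃ y) with hz
    have hz0 : γ *ᵥ z ≠ 0 := by
      intro h0
      have hz' : z = 0 := by
        apply mulVec_injective_iff_isUnit.2 ((isUnit_iff_isUnit_det _).2 hγ)
        rw [h0, mulVec_zero]
      apply hne
      rw [← one_mulVec (x ⨯₃ y), ← J_mul_J, ← mulVec_mulVec, ← hz, hz', mulVec_zero]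
    obtain ⟨i, hi⟩ := Function.ne_iff.1 hz0
    have e1 := minor_formEval (x := γ *ᵥ x) (y := γ *ᵥ y) (by linarith) (by linarith)
      (exteriorPower.map 2 α ω) i
    rw [hminor] at e1
    have e2 : (5 * minor (formEval x x) (formEval x y) ω) • (γ *ᵥ x) =
        (-2 * cubic (tensor (wedgeCoeffs ω)) x) • (γ *ᵥ z) := by
      rw [← mulVec_smul, ← mulVec_smul]
      congr 1
      ext j
      exact minor_formEval hx hxy ω j
    have e2' := congrFun e2 i
    have e3 := congrFun (hcross x y) i
    simp only [Pi.smul_apply, smul_eq_mul, ← hz] at e2' e3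
    apply mul_right_cancel₀ hi
    -- The minor is eliminated between the identity at `γx` and the `γ`-image of the identity at
    -- `x`; `e3` converts the cross product. The common factor `(γz)ᵢ` is nonzero by the choice of
    -- `i`.
    linear_combination (l / 2) * e1 - (l * μ ^ 2 / 2) * e2' -
      cubic (tensor (wedgeCoeffs (exteriorPower.map 2 α ω))) (γ *ᵥ x) * e3
  -- Both sides are harmonic, so it suffices to compare their cubic forms on the null cone.
  rw [← sub_eq_zero]
  apply (((isHarmonic_tensor _).pull hJ).sub ((isHarmonic_tensor _).smul _)).eq_zero
  intro x hx
  have hsub : ∀ (F G : Fin 3 → Matrix (Fin 3) (Fin 3) ℝ) (r : ℝ),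
      cubic (F - r • G) x = cubic F x - r * cubic G x := by
    intro F G r
    simp [cubic, sub_mulVec, smul_mulVec, mul_sub, Finset.mul_sum, mul_left_comm]
  rw [hsub, cubic_pull, sub_eq_zero, div_mul_eq_mul_div, eq_div_iff hγ.ne_zero]
  by_cases h2 : x 2 = 0
  · by_cases h0 : x 0 = 0
    · have h1 : x 1 = 0 := by
        rw [h0] at hx
        simpa using hx
      have : x = 0 := by
        ext i
        fin_cases i <;> assumption
      simp [this, cubic]
    -- The auxiliary `y` must be tangent to the cone at `x` without being parallel to `x`. Here `x ×
    -- y` has last entry `x₀²`; for the other choice below its first entry is `-x₂²`.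
    · apply key x ![0, x 0, x 1] hx
      · simp; ring
      · intro hc
        have := congrFun hc 2
        simp [cross_apply, h0] at this
  · apply key x ![x 1, x 2, 0] hx
    · simp; ring
    · intro hc
      have := congrFun hc 0
      simp [cross_apply, h2] at this

/-! ### Stabilizers of generic tensors and the resulting rigidity of `α` -/

/-- The Gram matrix of a tensor, with one index raised. -/
def gram (F : Fin 3 → Matrix (Fin 3) (Fin 3) ℝ) : Matrix (Fin 3) (Fin 3) ℝ :=
  J * of fun i j => trace (J * F i * (J * F j))

/-- A vector attached equivariantly to a cubic tensor. -/
def covector (F : Fin 3 → Matrix (Fin 3) (Fin 3) ℝ) : Fin 3 → ℝ :=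
  J *ᵥ fun i => trace (J * F i * gram F)

/-- The matrix with columns `L, N L, N² L` for `N = gram F` and `L = covector F`. -/
def frame (F : Fin 3 → Matrix (Fin 3) (Fin 3) ℝ) : Matrix (Fin 3) (Fin 3) ℝ :=
  (of ![covector F, gram F *ᵥ covector F, gram F *ᵥ (gram F *ᵥ covector F)])ᵀ

/-- An invariant which does not vanish on generic tensors. -/
def invariant (F : Fin 3 → Matrix (Fin 3) (Fin 3) ℝ) : ℝ :=
  trace (gram F) * (frame F).det

/-- `gram F` and `covector F` are built naturally from `F` and `J`, so `γ` respects them up to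
powers of `l` and `κ`. A map commuting with `N` and having a cyclic vector of `N` as eigenvector is
scalar. -/
theorem scalar_of_pull_eq {F : Fin 3 → Matrix (Fin 3) (Fin 3) ℝ}
    {γ : Matrix (Fin 3) (Fin 3) ℝ} {l κ : ℝ} (hγ : IsUnit γ.det) (hκ : κ ≠ 0)
    (hJ : γ * J * γᵀ = l • J) (hF : pull γ F = κ • F) (hinv : invariant F ≠ 0) :
    ∃ ρ : ℝ, γ = ρ • (1 : Matrix (Fin 3) (Fin 3) ℝ) := by
  have htr : trace (gram F) ≠ 0 := left_ne_zero_of_mul hinv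
  have hdet : (frame F).det ≠ 0 := right_ne_zero_of_mul hinv
  -- `D` transforms only the first index of `F`, so that `pull γ F k = γᵀ D_k γ`.
  set D : Fin 3 → Matrix (Fin 3) (Fin 3) ℝ := fun k => ∑ m, γ m k • F m with hD
  have hDF : ∀ k, γᵀ * D k * γ = κ • F k := by
    intro k
    rw [← Pi.smul_apply, ← hF]
    simp only [hD, pull, Matrix.mul_sum, Matrix.sum_mul, mul_smul_comm, smul_mul_assoc]
  set B : Matrix (Fin 3) (Fin 3) ℝ := of fun i j => trace (J * F i * (J * F j)) with hB
  have hN : gram F = J * B := rfl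
  have hDB : ∀ i j, trace (J * D i * (J * D j)) = (γᵀ * B * γ) i j := by
    intro i j
    simp only [hD, Matrix.mul_sum, Matrix.sum_mul, trace_sum, mul_smul_comm, smul_mul_assoc,
      trace_smul, smul_eq_mul, Matrix.mul_apply, transpose_apply, hB, of_apply, Finset.sum_mul, Finset.mul_sum]
    refine Finset.sum_congr rfl fun a _ => Finset.sum_congr rfl fun b _ => ?_
    ring
  have hBγ : l ^ 2 • (γᵀ * B * γ) = κ ^ 2 • B := by
    ext i j
    rw [Matrix.smul_apply, Matrix.smul_apply, ← hDB]
    have e1 : l ^ 2 • trace (J * D i * (J * D j)) =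
        trace ((γ * J * γᵀ) * D i * ((γ * J * γᵀ) * D j)) := by
      rw [hJ]
      simp only [smul_mul_assoc, mul_smul_comm, trace_smul, smul_smul, pow_two]
    have e2 : trace ((γ * J * γᵀ) * D i * ((γ * J * γᵀ) * D j)) =
        trace (J * (γᵀ * D i * γ) * (J * (γᵀ * D j * γ))) := by
      rw [show (γ * J * γᵀ) * D i * ((γ * J * γᵀ) * D j) =
        γ * (J * γᵀ * D i * (γ * J * γᵀ) * D j) by simp only [Matrix.mul_assoc],
        trace_mul_comm]
      simp only [Matrix.mul_assoc]
    rw [e1, e2, hDF, hDF]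
    simp only [smul_mul_assoc, mul_smul_comm, trace_smul, smul_smul, pow_two]
    rfl
  have hNγ : l ^ 3 • (gram F * γ) = κ ^ 2 • (γ * gram F) := by
    have := congrArg (fun M => γ * J * M) hBγ
    simp only [mul_smul_comm] at this
    rw [show γ * J * (γᵀ * B * γ) = (γ * J * γᵀ) * (B * γ) by simp only [Matrix.mul_assoc], hJ,
      smul_mul_assoc, smul_smul, ← pow_succ] at this
    rw [hN]
    simpa only [Matrix.mul_assoc] using this
  -- Conjugation by `γ` preserves the trace, and `tr N ≠ 0`, so the scale factors must agree and `γ`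
  -- commutes with `N` exactly.
  have hlκ : l ^ 3 = κ ^ 2 := by
    have := congrArg (fun M => trace (M * γ⁻¹)) hNγ
    simp only [smul_mul_assoc, trace_smul, smul_eq_mul] at this
    rw [Matrix.mul_assoc, Matrix.mul_nonsing_inv _ hγ, Matrix.mul_one, trace_mul_comm,
      ← Matrix.mul_assoc, Matrix.nonsing_inv_mul _ hγ, Matrix.one_mul] at this
    exact mul_right_cancel₀ htr this
  have hcomm : gram F * γ = γ * gram F := by
    rw [hlκ] at hNγ
    exact smul_right_injective _ (pow_ne_zero 2 hκ) hNγ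
  set q : Fin 3 → ℝ := fun i => trace (J * F i * gram F) with hq
  have hL : covector F = J *ᵥ q := rfl
  have hqγ : l • (γᵀ *ᵥ q) = κ • q := by
    ext k
    have e0 : (γᵀ *ᵥ q) k = trace (J * D k * gram F) := by
      simp only [hD, hq, mulVec, dotProduct, transpose_apply, Matrix.mul_sum, Matrix.sum_mul,
        trace_sum, mul_smul_comm, smul_mul_assoc, trace_smul, smul_eq_mul]
    rw [Pi.smul_apply, Pi.smul_apply, e0, ← trace_smul, ← smul_mul_assoc, ← smul_mul_assoc, ← hJ,
      show γ * J * γᵀ * D k * gram F = γ * (J * γᵀ * D k * gram F) by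
        simp only [Matrix.mul_assoc], trace_mul_comm, Matrix.mul_assoc, hcomm,
      show J * γᵀ * D k * (γ * gram F) = J * (γᵀ * D k * γ) * gram F by
        simp only [Matrix.mul_assoc], hDF]
    simp only [smul_mul_assoc, mul_smul_comm, trace_smul, hq]
  have hLγ : γ *ᵥ covector F = (l ^ 2 / κ) • covector F := by
    have : κ • (γ *ᵥ covector F) = l ^ 2 • covector F := by
      rw [hL, mulVec_mulVec, ← mulVec_smul, ← hqγ, mulVec_smul, mulVec_mulVec, hJ, smul_mulVec,
        smul_smul, pow_two]
    rw [div_eq_inv_mul, ← smul_smul, ← this, smul_smul, inv_mul_cancel₀ hκ, one_smul]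
  have hcommV : ∀ x, γ *ᵥ (gram F *ᵥ x) = gram F *ᵥ (γ *ᵥ x) := by
    intro x
    rw [mulVec_mulVec, mulVec_mulVec, hcomm]
  refine ⟨l ^ 2 / κ, ?_⟩
  have hK : γ * frame F = ((l ^ 2 / κ) • (1 : Matrix (Fin 3) (Fin 3) ℝ)) * frame F := by
    rw [smul_mul_assoc, Matrix.one_mul]
    ext i j
    have hcol : (γ * frame F) i j = (γ *ᵥ (frame F)ᵀ j) i := rfl
    have hrow : (γ *ᵥ (frame F)ᵀ j) = (l ^ 2 / κ) • (frame F)ᵀ j := by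
      fin_cases j
      · exact hLγ
      · change γ *ᵥ (gram F *ᵥ covector F) = (l ^ 2 / κ) • (gram F *ᵥ covector F)
        rw [hcommV, hLγ, mulVec_smul]
      · change γ *ᵥ (gram F *ᵥ (gram F *ᵥ covector F)) =
          (l ^ 2 / κ) • (gram F *ᵥ (gram F *ᵥ covector F))
        rw [hcommV, hcommV, hLγ, mulVec_smul, mulVec_smul]
    rw [hcol, hrow]
    rfl
  have hu : IsUnit (frame F) := (isUnit_iff_isUnit_det _).2 (isUnit_iff_ne_zero.2 hdet)
  exact hu.mul_right_cancel hK

/-- Outside the zero set of the invariant, only `±1` stabilizes an element of `V'` up to sign. -/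
theorem eq_or_eq_neg_of_stabilizes (α : V ≃ₗ[ℝ] V)
    (hα : ∀ ω ∈ W, exteriorPower.map 2 α.toLinearMap ω ∈ W) {ω : ⋀[ℝ]^2 V}
    (hinv : invariant (tensor (wedgeCoeffs ω)) ≠ 0) {ε : ℝ} (hε : ε = 1 ∨ ε = -1)
    (hω : wedgeCoeffs (exteriorPower.map 2 α.toLinearMap ω) = ε • wedgeCoeffs ω) :
    (∀ v, α v = v) ∨ ∀ v, α v = -v := by
  obtain ⟨γ, μ, hγ, hμ, h⟩ := exists_congruence α hα
  obtain ⟨l, hl, hJ⟩ := congruence_preserves_J hγ h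
  have hε0 : ε ≠ 0 := by rcases hε with rfl | rfl <;> norm_num
  have hpull := pull_tensor_wedgeCoeffs (α := α.toLinearMap) hγ hl hJ h ω
  have hps : ∀ F, pull γ (ε • F) = ε • pull γ F := by
    intro F
    ext k : 1
    simp only [pull, Pi.smul_apply, mul_smul_comm, smul_mul_assoc, Finset.smul_sum]
    exact Finset.sum_congr rfl fun _ _ => smul_comm _ _ _
  rw [hω, tensor_smul, hps] at hpull
  have hpull' : pull γ (tensor (wedgeCoeffs ω)) =
      (ε⁻¹ * (l * μ ^ 2 / γ.det)) • tensor (wedgeCoeffs ω) := by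
    rw [← smul_smul, ← hpull, smul_smul, inv_mul_cancel₀ hε0, one_smul]
  obtain ⟨ρ, hρ⟩ := scalar_of_pull_eq hγ (mul_ne_zero (inv_ne_zero hε0)
    (div_ne_zero (mul_ne_zero hl (pow_ne_zero 2 hμ)) hγ.ne_zero)) hJ hpull' hinv
  have hρ0 : ρ ≠ 0 := by
    rintro rfl
    rw [zero_smul] at hρ
    simp [hρ] at hγ
  have hscal : ∀ v, α v = (μ / ρ ^ 2) • v := by
    intro v
    have hv := h v
    rw [hρ] at hv
    simp only [transpose_smul, transpose_one, smul_mul_assoc, Matrix.one_mul, mul_smul_comm,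
      Matrix.mul_one, smul_smul, ← pow_two] at hv
    apply Subtype.ext
    change (α v).1 = (μ / ρ ^ 2) • v.1
    rw [div_eq_inv_mul, ← smul_smul, ← hv, smul_smul, inv_mul_cancel₀ (pow_ne_zero 2 hρ0),
      one_smul]
  set a := μ / ρ ^ 2 with ha
  have hmap : exteriorPower.map 2 α.toLinearMap = a ^ 2 • LinearMap.id := by
    apply linearMap_ext_wedge
    intro v w
    simp only [map_wedge, LinearEquiv.coe_coe, hscal, wedge_smul_left, wedge_smul_right,
      smul_smul, LinearMap.smul_apply, LinearMap.id_apply, pow_two]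
  rw [hmap, LinearMap.smul_apply, LinearMap.id_apply, map_smul] at hω
  have hc : wedgeCoeffs ω ≠ 0 := by
    intro h0
    apply hinv
    have ht : tensor 0 = 0 := by
      have := tensor_smul 0 0
      rwa [zero_smul, zero_smul] at this
    have hg : gram 0 = 0 := by
      ext
      simp [gram, Matrix.mul_apply]
    simp [h0, ht, invariant, hg]
  have haε : a ^ 2 = ε := smul_left_injective ℝ hc hω
  -- The sign `ε = -1` is impossible because `a` is real.
  have ha1 : a ^ 2 = 1 := by
    rcases hε with rfl | rfl
    · exact haε
    · nlinarith [sq_nonneg a]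
  rcases mul_self_eq_one_iff.1 ((pow_two a).symm.trans ha1) with h1 | h1
  · exact Or.inl fun v => by rw [hscal, h1, one_smul]
  · exact Or.inr fun v => by rw [hscal, h1]; module

/-! ### The degenerate set is null -/

/-- The zero set of a nonzero homogeneous analytic function has measure zero. -/
theorem volume_zeros_eq_zero {n : ℕ} {f : (Fin n → ℝ) → ℝ} (hf : AnalyticOnNhd ℝ f Set.univ)
    {d : ℕ} (hd : ∀ (r : ℝ) x, f (r • x) = r ^ d * f x) {x₀ : Fin n → ℝ} (hx₀ : f x₀ ≠ 0) :
    MeasureTheory.volume {x | f x = 0} = 0 := by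
  have hc : Continuous f := continuousOn_univ.1 hf.continuousOn
  have hs : MeasurableSet {x | f x ≠ 0} := (isOpen_ne_fun hc continuous_const).measurableSet
  have h : ∀ᵐ x, x ∈ {x | f x ≠ 0} := by
    -- By Fubini it is enough to treat the lines parallel to `x₀`.
    refine MeasureTheory.ae_mem_of_ae_add_linearMap_mem
      (LinearMap.toSpanSingleton ℝ (Fin n → ℝ) x₀) MeasureTheory.volume MeasureTheory.volume hs ?_
    intro y
    have hg : AnalyticOnNhd ℝ (fun t : ℝ => f (y + t • x₀)) Set.univ := by
      intro t _
      have h1 : AnalyticAt ℝ (fun t : ℝ => y + t • x₀) t := by fun_prop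
      exact AnalyticAt.fun_comp (hf _ trivial) h1
    -- By homogeneity `f(sy + x₀) = s^d f(y + s⁻¹x₀)`, and the left side is nonzero for small `s`.
    -- So `f` is not identically zero on any such line.
    obtain ⟨s, hs0, hs⟩ : ∃ s : ℝ, s ≠ 0 ∧ f (s • y + x₀) ≠ 0 := by
      have hcs : ContinuousAt (fun s : ℝ => f (s • y + x₀)) 0 := by fun_prop
      have hev := hcs.eventually_ne (y := 0) (by simpa using hx₀)
      have h2 : ∀ᶠ s : ℝ in nhdsWithin 0 {0}ᶜ, f (s • y + x₀) ≠ 0 := hev.filter_mono inf_le_left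
      obtain ⟨s, hs1, hs2⟩ := (h2.and self_mem_nhdsWithin).exists
      exact ⟨s, hs2, hs1⟩
    have hne : (fun t : ℝ => f (y + t • x₀)) s⁻¹ ≠ 0 := by
      intro h0
      apply hs
      have : s • y + x₀ = s • (y + s⁻¹ • x₀) := by
        rw [smul_add, smul_smul, mul_inv_cancel₀ hs0, one_smul]
      rw [this, hd]
      simp only at h0
      rw [h0, mul_zero]
    have hcod := hg.preimage_zero_mem_codiscrete hne
    have hle := ae_restrict_le_codiscreteWithin
      (μ := (MeasureTheory.volume : MeasureTheory.Measure ℝ)) (U := Set.univ) MeasurableSet.univ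
    rw [MeasureTheory.Measure.restrict_univ] at hle
    filter_upwards [hle hcod] with t ht
    exact ht
  rw [MeasureTheory.ae_iff] at h
  simpa using h

section analytic

variable {E : Type*} [NormedAddCommGroup E] [NormedSpace ℝ E]

/-- A matrix-valued function all of whose entries are analytic. -/
def EntrywiseAnalytic (M : E → Matrix (Fin 3) (Fin 3) ℝ) : Prop :=
  ∀ i j, AnalyticOnNhd ℝ (fun x => M x i j) Set.univ

theorem EntrywiseAnalytic.mul {M N : E → Matrix (Fin 3) (Fin 3) ℝ} (hM : EntrywiseAnalytic M)
    (hN : EntrywiseAnalytic N) : EntrywiseAnalytic fun x => M x * N x := by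
  intro i j
  simp only [Matrix.mul_apply]
  exact Finset.analyticOnNhd_fun_sum _ fun k _ => (hM i k).mul (hN k j)

theorem EntrywiseAnalytic.const (M : Matrix (Fin 3) (Fin 3) ℝ) :
    EntrywiseAnalytic fun _ : E => M := fun _ _ => analyticOnNhd_const

theorem EntrywiseAnalytic.trace {M : E → Matrix (Fin 3) (Fin 3) ℝ} (hM : EntrywiseAnalytic M) :
    AnalyticOnNhd ℝ (fun x => (M x).trace) Set.univ :=
  Finset.analyticOnNhd_fun_sum _ fun k _ => hM k k

theorem EntrywiseAnalytic.mulVec {M : E → Matrix (Fin 3) (Fin 3) ℝ} (hM : EntrywiseAnalytic M)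
    {v : E → Fin 3 → ℝ} (hv : ∀ i, AnalyticOnNhd ℝ (fun x => v x i) Set.univ) (i : Fin 3) :
    AnalyticOnNhd ℝ (fun x => (M x *ᵥ v x) i) Set.univ := by
  simp only [Matrix.mulVec, dotProduct]
  exact Finset.analyticOnNhd_fun_sum _ fun k _ => (hM i k).mul (hv k)

theorem EntrywiseAnalytic.det {M : E → Matrix (Fin 3) (Fin 3) ℝ} (hM : EntrywiseAnalytic M) :
    AnalyticOnNhd ℝ (fun x => (M x).det) Set.univ := by
  simp only [det_fin_three]
  intro x _
  have h : ∀ i j, AnalyticAt ℝ (fun x => M x i j) x := fun i j => hM i j x trivial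
  fun_prop

theorem analyticOnNhd_invariant {F : E → Fin 3 → Matrix (Fin 3) (Fin 3) ℝ}
    (hF : ∀ k, EntrywiseAnalytic fun x => F x k) :
    AnalyticOnNhd ℝ (fun x => invariant (F x)) Set.univ := by
  have hJF : ∀ k, EntrywiseAnalytic fun x => J * F x k := fun k =>
    (EntrywiseAnalytic.const J).mul (hF k)
  have hN : EntrywiseAnalytic fun x => gram (F x) :=
    (EntrywiseAnalytic.const J).mul fun i j => ((hJF i).mul (hJF j)).trace
  have hL : ∀ i, AnalyticOnNhd ℝ (fun x => covector (F x) i) Set.univ :=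
    (EntrywiseAnalytic.const J).mulVec fun i => ((hJF i).mul hN).trace
  refine hN.trace.mul (EntrywiseAnalytic.det fun i j => ?_)
  fin_cases j
  · exact hL i
  · exact hN.mulVec hL i
  · exact hN.mulVec (hN.mulVec hL) i

theorem analyticOnNhd_invariant_tensor {c : E → Fin 7 → ℝ}
    (hc : ∀ i, AnalyticOnNhd ℝ (fun x => c x i) Set.univ) :
    AnalyticOnNhd ℝ (fun x => invariant (tensor (c x))) Set.univ := by
  apply analyticOnNhd_invariant
  intro k i j x _
  have h : ∀ i, AnalyticAt ℝ (fun x => c x i) x := fun i => hc i x trivial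
  fin_cases k <;> fin_cases i <;> fin_cases j <;> simp [tensor] <;> fun_prop

end analytic

theorem gram_smul (r : ℝ) (F : Fin 3 → Matrix (Fin 3) (Fin 3) ℝ) :
    gram (r • F) = r ^ 2 • gram F := by
  rw [gram, gram, ← mul_smul_comm]
  congr 1
  ext i j
  simp [pow_two, mul_assoc]

theorem covector_smul (r : ℝ) (F : Fin 3 → Matrix (Fin 3) (Fin 3) ℝ) :
    covector (r • F) = r ^ 3 • covector F := by
  rw [covector, covector, ← mulVec_smul]
  congr 1
  ext i
  simp [gram_smul]
  ring

/-- The degree is `2` for the trace of `N`, plus `3 + 5 + 7` for the columns `L`, `NL`, `N²L`. -/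
theorem invariant_smul (r : ℝ) (F : Fin 3 → Matrix (Fin 3) (Fin 3) ℝ) :
    invariant (r • F) = r ^ 17 * invariant F := by
  simp only [invariant, frame, gram_smul, covector_smul, det_fin_three, trace_smul, smul_mulVec,
    mulVec_smul, smul_smul]
  simp
  ring

/-- The elements of `V'` at which the invariant vanishes. -/
def degenerate : Set V' := {y | invariant (tensor (coeffs y)) = 0}

theorem exists_not_mem_degenerate : ∃ y, y ∉ degenerate := by
  -- For this choice `N` is upper triangular with diagonal `50` and nonzero superdiagonal, and `L`
  -- is a multiple of the last basis vector, hence cyclic.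
  refine ⟨W.mkQ (wedge σ₁ σ₃ + wedge σ₃ σ₅ + wedge σ₄ σ₅), ?_⟩
  have hc : coeffs (W.mkQ (wedge σ₁ σ₃ + wedge σ₃ σ₅ + wedge σ₄ σ₅)) = ![0, 1, 0, 0, 0, 1, 1] := by
    rw [coeffs_mkQ, map_add, map_add, wedgeCoeffs_wedge, wedgeCoeffs_wedge, wedgeCoeffs_wedge]
    ext i
    fin_cases i <;> simp [σ₁, σ₃, σ₄, σ₅]
  have hT : tensor ![0, 1, 0, 0, 0, 1, 1] =
      ![!![0, 5, 0; 5, 0, 0; 0, 0, 0], !![5, 0, 0; 0, 0, 0; 0, 0, 5],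
        !![0, 0, 0; 0, 0, 5; 0, 5, 5]] := by
    ext k i j
    fin_cases k <;> fin_cases i <;> fin_cases j <;> simp [tensor]
  have hN : gram (tensor ![0, 1, 0, 0, 0, 1, 1]) = !![50, -25, 0; 0, 50, 25; 0, 0, 50] := by
    rw [hT]
    ext i j
    fin_cases i <;> fin_cases j <;>
      simp [gram, J, Matrix.mul_apply, trace, Fin.sum_univ_three] <;> norm_num
  have hL : covector (tensor ![0, 1, 0, 0, 0, 1, 1]) = ![0, 0, 250] := by
    rw [covector, hN, hT]
    ext i
    fin_cases i <;> simp [J, mulVec, dotProduct, trace, Fin.sum_univ_three] <;> norm_num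
  have h1 : !![50, -25, 0; 0, 50, 25; 0, 0, 50] *ᵥ ![0, 0, 250] = ![0, 6250, (12500 : ℝ)] := by
    ext i
    fin_cases i <;> simp [mulVec, dotProduct, Fin.sum_univ_three] <;> norm_num
  have h2 : !![50, -25, 0; 0, 50, 25; 0, 0, 50] *ᵥ ![0, 6250, 12500] =
      ![-156250, 625000, (625000 : ℝ)] := by
    ext i
    fin_cases i <;> simp [mulVec, dotProduct, Fin.sum_univ_three] <;> norm_num
  change ¬ invariant _ = 0
  rw [hc, invariant, frame, hN, hL, h1, h2, det_fin_three]
  simp [trace, Fin.sum_univ_three]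
  norm_num

theorem volume_degenerate :
    MeasureTheory.volume ((Module.finBasis ℝ V').equivFun '' degenerate) = 0 := by
  set e := (Module.finBasis ℝ V').equivFun
  have himage : e '' degenerate = {x | invariant (tensor (coeffs (e.symm x))) = 0} := by
    ext x
    constructor
    · rintro ⟨y, hy, rfl⟩
      simpa [degenerate] using hy
    · intro hx
      exact ⟨e.symm x, hx, by simp⟩
  rw [himage]
  obtain ⟨y, hy⟩ := exists_not_mem_degenerate
  refine volume_zeros_eq_zero (d := 17) (x₀ := e y)
    (analyticOnNhd_invariant_tensor fun i => ?_) ?_ ?_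
  · have := ((LinearMap.proj (R := ℝ) (φ := fun _ : Fin 7 => ℝ) i ∘ₗ coeffs ∘ₗ
      e.symm.toLinearMap).toContinuousLinearMap).analyticOnNhd Set.univ
    exact this
  · intro r x
    simp only [map_smul, tensor_smul, invariant_smul]
  · simpa [degenerate] using hy

/-! ### The quotient group and the linear map induced by an automorphism -/

section

variable (θ : commutator NilGroup)

/-- The projection of `G'` onto `V`. -/
noncomputable def quoToV : Quo θ →* Multiplicative V :=
  QuotientGroup.lift _ NilGroup.toV (by
    have h : Subgroup.zpowers (θ : NilGroup) ≤ NilGroup.toV.ker := by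
      rw [Subgroup.zpowers_le, MonoidHom.mem_ker]
      exact congrArg Multiplicative.ofAdd ((NilGroup.mem_commutator_iff _).1 θ.2)
    exact h)

theorem quoToV_mk (g : NilGroup) :
    quoToV θ (QuotientGroup.mk g) = Multiplicative.ofAdd g.log.1 := rfl

theorem continuous_log_fst : Continuous fun g : NilGroup => g.log.1 := by
  let _ : TopologicalSpace NilAlg := moduleTopology ℝ NilAlg
  have : IsModuleTopology ℝ NilAlg := ⟨rfl⟩
  let p : NilAlg →ₗ[ℝ] V := LinearMap.fst ℝ V V'
  have hp : Continuous p := IsModuleTopology.continuous_of_linearMap p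
  exact hp.comp NilGroup.logHomeomorph.continuous

/-- The map induced by a linear map of Lie algebras on the level of exponentials is continuous. -/
theorem continuous_exp_linearMap {E : Type*} [AddCommGroup E] [Module ℝ E] [TopologicalSpace E]
    [IsTopologicalAddGroup E] [ContinuousSMul ℝ E] [T2Space E] [FiniteDimensional ℝ E]
    (f : E →ₗ[ℝ] NilAlg) : Continuous fun x => NilGroup.exp (f x) := by
  let _ : TopologicalSpace NilAlg := moduleTopology ℝ NilAlg
  have : IsModuleTopology ℝ NilAlg := ⟨rfl⟩
  have := IsModuleTopology.topologicalAddGroup ℝ NilAlg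
  have := IsModuleTopology.toContinuousSMul ℝ NilAlg
  exact NilGroup.logHomeomorph.symm.continuous.comp f.continuous_of_finiteDimensional

theorem continuous_exp_comp_log (f : NilAlg →ₗ[ℝ] NilAlg) :
    Continuous fun g : NilGroup => NilGroup.exp (f g.log) := by
  let _ : TopologicalSpace NilAlg := moduleTopology ℝ NilAlg
  have : IsModuleTopology ℝ NilAlg := ⟨rfl⟩
  have := IsModuleTopology.topologicalAddGroup ℝ NilAlg
  have := IsModuleTopology.toContinuousSMul ℝ NilAlg
  have hf : Continuous f := IsModuleTopology.continuous_of_linearMap f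
  exact NilGroup.logHomeomorph.symm.continuous.comp (hf.comp NilGroup.logHomeomorph.continuous)

theorem mem_commutator_quo_iff (g : Quo θ) : g ∈ commutator (Quo θ) ↔ quoToV θ g = 1 := by
  constructor
  · intro hg
    exact MonoidHom.mem_ker.1 (Abelianization.commutator_subset_ker (quoToV θ) hg)
  · induction g using QuotientGroup.induction_on with
    | H g =>
      intro hg
      rw [quoToV_mk] at hg
      have h0 : g ∈ commutator NilGroup := (NilGroup.mem_commutator_iff g).2
        (Multiplicative.ofAdd.injective hg)
      have hle : ⁅(⊤ : Subgroup NilGroup), ⊤⁆ ≤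
          (commutator (Quo θ)).comap (QuotientGroup.mk' (Subgroup.zpowers (θ : NilGroup))) := by
        refine Subgroup.commutator_le.2 fun a _ b _ => ?_
        rw [Subgroup.mem_comap, map_commutatorElement]
        exact Subgroup.commutator_mem_commutator trivial trivial
      exact hle h0

theorem isClosed_commutator_quo : IsClosed (commutator (Quo θ) : Set (Quo θ)) := by
  have hc : Continuous fun g : Quo θ => (Multiplicative.toAdd (quoToV θ g) : V) := by
    apply continuous_quot_lift
    exact continuous_log_fst
  have : (commutator (Quo θ) : Set (Quo θ)) =
      (fun g : Quo θ => (Multiplicative.toAdd (quoToV θ g) : V)) ⁻¹' {0} := by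
    ext g
    rw [SetLike.mem_coe, mem_commutator_quo_iff]
    rfl
  rw [this]
  exact isClosed_singleton.preimage hc

/-- The central vector group `V'` of `G`. -/
noncomputable def expCenter : Multiplicative V' →* NilGroup where
  toFun y := NilGroup.exp (0, Multiplicative.toAdd y)
  map_one' := rfl
  map_mul' x y := by
    ext1
    rw [NilGroup.log_mul]
    apply NilAlg.ext
    · change (0 : V) = 0 + 0 + (1 / 2 : ℝ) • (0 : V)
      simp
    · change Multiplicative.toAdd x + Multiplicative.toAdd y =
        Multiplicative.toAdd x + Multiplicative.toAdd y + (1 / 2 : ℝ) • wedgeMod 0 0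
      simp

/-- The image in `G'` of the central vector group `V'`. -/
noncomputable def centralHom : Multiplicative V' →* Quo θ :=
  (QuotientGroup.mk' _).comp expCenter

theorem zpow_log_snd (n : ℤ) :
    ((θ : NilGroup) ^ n) = NilGroup.exp (0, n • (θ : NilGroup).log.2) := by
  have h : (θ : NilGroup) = expCenter (Multiplicative.ofAdd (θ : NilGroup).log.2) := by
    ext1
    exact NilAlg.ext ((NilGroup.mem_commutator_iff _).1 θ.2) rfl
  rw [h, ← map_zpow, ← ofAdd_zsmul]
  rfl

theorem centralHom_eq_one_iff (y : V') :
    centralHom θ (Multiplicative.ofAdd y) = 1 ↔ ∃ n : ℤ, y = n • (θ : NilGroup).log.2 := by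
  have h : centralHom θ (Multiplicative.ofAdd y) = 1 ↔
      NilGroup.exp (0, y) ∈ Subgroup.zpowers (θ : NilGroup) := QuotientGroup.eq_one_iff _
  rw [h, Subgroup.mem_zpowers_iff]
  refine exists_congr fun n => ?_
  rw [zpow_log_snd]
  constructor
  · intro h
    exact (congrArg (fun g : NilGroup => g.log.2) h).symm
  · rintro rfl
    rfl

/-- A real line cannot lie in a cyclic group unless it is zero. This separates `W` from the discrete
ambiguity caused by `θ`. -/
theorem eq_zero_of_smul_mem {y z : V'} (h : ∀ t : ℝ, ∃ n : ℤ, t • y = n • z) : y = 0 := by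
  obtain ⟨n, hn⟩ := h 1
  rw [one_smul] at hn
  by_cases hn0 : n = 0
  · rw [hn, hn0, zero_smul]
  -- With `y = nz`, this parameter gives `z/2`, which is an integer multiple of `z` only if `z = 0`.
  obtain ⟨m, hm⟩ := h (1 / (2 * n))
  rw [hn, ← Int.cast_smul_eq_zsmul ℝ, ← Int.cast_smul_eq_zsmul ℝ, smul_smul, ← sub_eq_zero,
    ← sub_smul, smul_eq_zero] at hm
  rcases hm with hm | hm
  · exfalso
    have hn' : (n : ℝ) ≠ 0 := Int.cast_ne_zero.2 hn0
    field_simp at hm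
    have : (1 : ℤ) - m * 2 = 0 := by
      have h2 : ((1 - m * 2 : ℤ) : ℝ) = 0 := by push_cast; linarith
      exact_mod_cast h2
    omega
  · rw [hn, hm, smul_zero]

theorem centralHom_wedge (g h : NilGroup) :
    (QuotientGroup.mk g * QuotientGroup.mk h * (QuotientGroup.mk g)⁻¹ * (QuotientGroup.mk h)⁻¹ :
      Quo θ) = centralHom θ (Multiplicative.ofAdd (W.mkQ (wedge g.log.1 h.log.1))) := by
  have : g * h * g⁻¹ * h⁻¹ = NilGroup.exp (0, W.mkQ (wedge g.log.1 h.log.1)) := by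
    ext1
    rw [NilGroup.log_commutator]
    rfl
  exact congrArg QuotientGroup.mk this

/-- A continuous automorphism of `G'` induces a linear map of `V`, and acts on the commutator
subgroup through its second exterior power. -/
theorem exists_linearMap (τ : Quo θ ≃ₜ* Quo θ) : ∃ α : V →ₗ[ℝ] V,
    (∀ g, Multiplicative.toAdd (quoToV θ (τ g)) = α (Multiplicative.toAdd (quoToV θ g))) ∧
    ∀ ω : ⋀[ℝ]^2 V, τ (centralHom θ (Multiplicative.ofAdd (W.mkQ ω))) =
      centralHom θ (Multiplicative.ofAdd (W.mkQ (exteriorPower.map 2 α ω))) := by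
  let s : V → Quo θ := fun v => QuotientGroup.mk (NilGroup.exp (v, 0))
  let p : Quo θ → V := fun g => Multiplicative.toAdd (quoToV θ g)
  have hp : Continuous p := continuous_quot_lift _ continuous_log_fst
  have hs : Continuous s := continuous_quot_mk.comp
    (continuous_exp_linearMap (LinearMap.inl ℝ V V' : V →ₗ[ℝ] NilAlg))
  have hps : ∀ v, p (s v) = v := fun _ => rfl
  have hpmul : ∀ g h, p (g * h) = p g + p h := fun g h => by
    change Multiplicative.toAdd _ = _
    rw [map_mul]
    rfl
  -- The section `s` is not a homomorphism. But `τ` preserves the commutator subgroup, so `p ∘ τ`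
  -- depends only on the class in `V`, which makes `a` additive.
  have hcongr : ∀ g h, p g = p h → p (τ g) = p (τ h) := by
    intro g h hgh
    have h1 : g⁻¹ * h ∈ commutator (Quo θ) := by
      rw [mem_commutator_quo_iff, map_mul, map_inv, inv_mul_eq_one]
      exact hgh
    have h2 : τ (g⁻¹ * h) ∈ commutator (Quo θ) :=
      (Subgroup.characteristic_iff_le_comap.1 inferInstance τ.toMulEquiv) h1
    rw [mem_commutator_quo_iff, map_mul, map_inv, map_mul, map_inv, inv_mul_eq_one] at h2
    exact h2
  let a : V →+ V :=
    { toFun := fun v => p (τ (s v))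
      map_zero' := by
        have : s 0 = 1 := rfl
        rw [this, map_one]
        rfl
      map_add' := fun v w => by
        rw [← hpmul, ← map_mul]
        apply hcongr
        rw [hpmul]
        rfl }
  have ha : Continuous a := hp.comp (τ.continuous.comp hs)
  -- A continuous additive map of real vector spaces is linear.
  let α : V →ₗ[ℝ] V := (a.toRealLinearMap ha).toLinearMap
  have hα : ∀ g, p (τ g) = α (p g) := fun g => hcongr _ _ (hps _).symm
  refine ⟨α, hα, ?_⟩
  let f₁ : ⋀[ℝ]^2 V → Quo θ := fun ω => τ (centralHom θ (Multiplicative.ofAdd (W.mkQ ω)))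
  let f₂ : ⋀[ℝ]^2 V → Quo θ := fun ω =>
    centralHom θ (Multiplicative.ofAdd (W.mkQ (exteriorPower.map 2 α ω)))
  have hadd₁ : ∀ x y, f₁ (x + y) = f₁ x * f₁ y := fun x y => by
    simp only [f₁, map_add, ofAdd_add, map_mul]
  have hadd₂ : ∀ x y, f₂ (x + y) = f₂ x * f₂ y := fun x y => by
    simp only [f₂, map_add, ofAdd_add, map_mul]
  have hwedge : ∀ v w, f₁ (wedge v w) = f₂ (wedge v w) := by
    intro v w
    have e1 := centralHom_wedge θ (NilGroup.exp (v, 0)) (NilGroup.exp (w, 0))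
    obtain ⟨g, hg⟩ := QuotientGroup.mk_surjective (τ (s v))
    obtain ⟨h, hh⟩ := QuotientGroup.mk_surjective (τ (s w))
    have e2 := centralHom_wedge θ g h
    have hg' : g.log.1 = α v := by rw [← hps v, ← hα, ← hg]; rfl
    have hh' : h.log.1 = α w := by rw [← hps w, ← hα, ← hh]; rfl
    rw [hg, hh, ← map_inv, ← map_inv, ← map_mul, ← map_mul, ← map_mul, hg', hh',
      ← map_wedge] at e2
    exact (congrArg τ e1).symm.trans e2
  -- `f₁` and `f₂` are only known to be additive, so real scalars are absorbed into the first factor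
  -- of a wedge.
  have key : ∀ ω ∈ Submodule.span ℝ (Set.range (exteriorPower.ιMulti ℝ 2 (M := V))),
      ∀ c : ℝ, f₁ (c • ω) = f₂ (c • ω) := by
    intro ω hω
    induction hω using Submodule.span_induction with
    | mem x hx =>
      obtain ⟨m, rfl⟩ := hx
      intro c
      have hm : m = ![m 0, m 1] := by
        ext i : 1
        fin_cases i <;> rfl
      have : c • exteriorPower.ιMulti ℝ 2 m = wedge (c • m 0) (m 1) := by
        rw [wedge_smul_left, wedge, ← hm]
      rw [this, hwedge]
    | zero => intro c; rw [smul_zero]; simp [f₁, f₂]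
    | add x y _ _ hx hy => intro c; rw [smul_add, hadd₁, hadd₂, hx, hy]
    | smul b x _ hx => intro c; rw [smul_smul]; exact hx _
  intro ω
  have := key ω (by rw [exteriorPower.ιMulti_span]; trivial) 1
  rwa [one_smul] at this

end

section

variable (θ : commutator NilGroup)

theorem neg_one_smul_V (v : V) : (-1 : ℝ) • v = -v := by module

theorem eq_zero_of_eq_neg {v : V} (h : v = -v) : v = 0 := by
  refine Subtype.ext (Matrix.ext fun i j => ?_)
  have h1 : v.1 i j = -v.1 i j := congrFun (congrFun (congrArg Subtype.val h) i) j
  change v.1 i j = 0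
  linarith

/-- If mutually inverse maps act on a class modulo `W` by integers, these are inverse. -/
theorem mul_eq_one_of_quotient_action {M : Type*} [AddCommGroup M] [Module ℝ M]
    {W : Submodule ℝ M} {f g : M →ₗ[ℝ] M} (hg : ∀ ω ∈ W, g ω ∈ W) (hgf : ∀ ω, g (f ω) = ω)
    {ω : M} {n m : ℤ} (hn : W.mkQ (f ω) = n • W.mkQ ω) (hm : W.mkQ (g ω) = m • W.mkQ ω)
    (h0 : W.mkQ ω ≠ 0) : n * m = 1 := by
  have h1 : f ω - n • ω ∈ W := by
    rw [← Submodule.Quotient.mk_eq_zero, ← Submodule.mkQ_apply, map_sub, map_zsmul, hn, sub_self]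
  have h2 := hg _ h1
  rw [← Submodule.Quotient.mk_eq_zero, ← Submodule.mkQ_apply, map_sub, map_zsmul, map_sub,
    map_zsmul, hgf, hm, smul_smul, sub_eq_zero] at h2
  have h3 : ((n * m - 1 : ℤ) : ℝ) • W.mkQ ω = 0 := by
    rw [Int.cast_smul_eq_zsmul, sub_smul, one_smul, ← h2, sub_self]
  have h4 := (smul_eq_zero.1 h3).resolve_right h0
  have h5 : n * m - 1 = 0 := by exact_mod_cast h4
  omega

theorem ne_zero_of_not_mem_degenerate {y : V'} (hy : y ∉ degenerate) : y ≠ 0 := by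
  rintro rfl
  apply hy
  have h : tensor 0 = (0 : ℝ) • tensor 0 := by rw [← tensor_smul, zero_smul]
  change invariant (tensor (coeffs 0)) = 0
  rw [map_zero, h, invariant_smul]
  norm_num

theorem exteriorPower_map_smul_id {ε : ℝ} (hε : ε = 1 ∨ ε = -1) {α : V →ₗ[ℝ] V}
    (hα : ∀ v, α v = ε • v) : exteriorPower.map 2 α = LinearMap.id := by
  apply linearMap_ext_wedge
  intro v w
  rw [map_wedge, hα, hα, wedge_smul_left, wedge_smul_right, smul_smul]
  rcases hε with rfl | rfl <;> simp

/-- For generic `θ` every continuous automorphism of `G'` acts by `±1` on `V`, and trivially on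
the commutator subgroup. -/
theorem automorphism_rigid (hθ : (θ : NilGroup).log.2 ∉ degenerate) (τ : Quo θ ≃ₜ* Quo θ) :
    ∃ ε : ℝ, (ε = 1 ∨ ε = -1) ∧
      (∀ g, Multiplicative.toAdd (quoToV θ (τ g)) = ε • Multiplicative.toAdd (quoToV θ g)) ∧
      ∀ g ∈ commutator (Quo θ), τ g = g := by
  obtain ⟨α, hα, hα'⟩ := exists_linearMap θ τ
  obtain ⟨β, hβ, hβ'⟩ := exists_linearMap θ τ.symm
  have hsurj : ∀ v : V, ∃ g, Multiplicative.toAdd (quoToV θ g) = v := fun v =>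
    ⟨QuotientGroup.mk (NilGroup.exp (v, 0)), rfl⟩
  have hβα : β ∘ₗ α = LinearMap.id := by
    refine LinearMap.ext fun v => ?_
    obtain ⟨g, rfl⟩ := hsurj v
    rw [LinearMap.comp_apply, ← hα, ← hβ, τ.symm_apply_apply]
    rfl
  have hαβ : α ∘ₗ β = LinearMap.id := by
    refine LinearMap.ext fun v => ?_
    obtain ⟨g, rfl⟩ := hsurj v
    rw [LinearMap.comp_apply, ← hβ, ← hα, τ.apply_symm_apply]
    rfl
  set y := (θ : NilGroup).log.2 with hy
  -- The kernel of `V' → G'` is `ℤy`, and `σ` fixes the identity.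
  have hone : ∀ (σ : Quo θ ≃ₜ* Quo θ) (γ : V →ₗ[ℝ] V),
      (∀ ω : ⋀[ℝ]^2 V, σ (centralHom θ (Multiplicative.ofAdd (W.mkQ ω))) =
        centralHom θ (Multiplicative.ofAdd (W.mkQ (exteriorPower.map 2 γ ω)))) →
      ∀ (ω : ⋀[ℝ]^2 V) (n : ℤ), W.mkQ ω = n • y →
        ∃ m : ℤ, W.mkQ (exteriorPower.map 2 γ ω) = m • y := by
    intro σ γ h ω n hn
    rw [← centralHom_eq_one_iff, ← h, (centralHom_eq_one_iff θ _).2 ⟨n, hn⟩, map_one]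
  have hW : ∀ (σ : Quo θ ≃ₜ* Quo θ) (γ : V →ₗ[ℝ] V),
      (∀ ω : ⋀[ℝ]^2 V, σ (centralHom θ (Multiplicative.ofAdd (W.mkQ ω))) =
        centralHom θ (Multiplicative.ofAdd (W.mkQ (exteriorPower.map 2 γ ω)))) →
      ∀ ω ∈ W, exteriorPower.map 2 γ ω ∈ W := by
    intro σ γ h ω hω
    rw [← Submodule.Quotient.mk_eq_zero]
    apply eq_zero_of_smul_mem (z := y)
    intro t
    have h0 : W.mkQ (t • ω) = (0 : ℤ) • y := by
      rw [zero_smul]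
      exact (Submodule.Quotient.mk_eq_zero W).2 (W.smul_mem t hω)
    obtain ⟨m, hm⟩ := hone σ γ h _ 0 h0
    rw [map_smul, map_smul] at hm
    exact ⟨m, hm⟩
  obtain ⟨ω, hω⟩ := W.mkQ_surjective y
  obtain ⟨n, hn⟩ := hone τ α hα' ω 1 (by rw [hω, one_smul])
  obtain ⟨m, hm⟩ := hone τ.symm β hβ' ω 1 (by rw [hω, one_smul])
  have hy0 : y ≠ 0 := ne_zero_of_not_mem_degenerate hθ
  -- `α` and `β` come from inverse automorphisms, so the integers by which they multiply `y` are
  -- inverse to each other.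
  have hnm : n * m = 1 := by
    refine mul_eq_one_of_quotient_action (f := exteriorPower.map 2 α) (g := exteriorPower.map 2 β)
      (hW τ.symm β hβ') (fun ω => ?_) (by rw [hω]; exact hn) (by rw [hω]; exact hm)
      (by rw [hω]; exact hy0)
    rw [← LinearMap.comp_apply, ← exteriorPower.map_comp, hβα, exteriorPower.map_id,
      LinearMap.id_apply]
  have hn1 : (n : ℝ) = 1 ∨ (n : ℝ) = -1 := by
    rcases Int.eq_one_or_neg_one_of_mul_eq_one hnm with rfl | rfl <;> simp
  let e : V ≃ₗ[ℝ] V := LinearEquiv.ofLinearMap α β hαβ hβα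
  have he : e.toLinearMap = α := rfl
  have hrigid := eq_or_eq_neg_of_stabilizes e (by rw [he]; exact hW τ α hα') (ω := ω) (by
      rw [← coeffs_mkQ, hω]
      exact hθ) hn1 (by
      rw [he, ← coeffs_mkQ, ← coeffs_mkQ, hn, hω, Int.cast_smul_eq_zsmul, map_zsmul])
  obtain ⟨ε, hε, hαε⟩ : ∃ ε : ℝ, (ε = 1 ∨ ε = -1) ∧ ∀ v, α v = ε • v := by
    rcases hrigid with h | h
    · exact ⟨1, Or.inl rfl, fun v => by rw [one_smul]; exact h v⟩
    · exact ⟨-1, Or.inr rfl, fun v => (h v).trans (neg_one_smul_V v).symm⟩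
  refine ⟨ε, hε, fun g => by rw [hα, hαε], fun g hg => ?_⟩
  rw [mem_commutator_quo_iff] at hg
  obtain ⟨g, rfl⟩ := QuotientGroup.mk_surjective g
  rw [quoToV_mk] at hg
  obtain ⟨ω', hω'⟩ := W.mkQ_surjective g.log.2
  have hgc : (QuotientGroup.mk g : Quo θ) = centralHom θ (Multiplicative.ofAdd (W.mkQ ω')) := by
    refine congrArg QuotientGroup.mk ?_
    ext1
    exact NilAlg.ext (Multiplicative.ofAdd.injective hg) hω'.symm
  rw [hgc, hα', exteriorPower_map_smul_id hε hαε, LinearMap.id_apply]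

/-! ### Shear automorphisms and orbits -/

/-- The linear map `(v, y) ↦ (ε v, y + β v)`. -/
noncomputable def shear (ε : ℝ) (β : V →ₗ[ℝ] V') : NilAlg →ₗ[ℝ] NilAlg where
  toFun x := (ε • x.1, x.2 + β x.1)
  map_add' x y := NilAlg.ext (smul_add _ _ _) (by
    change x.2 + y.2 + β (x.1 + y.1) = x.2 + β x.1 + (y.2 + β y.1)
    rw [map_add]
    abel)
  map_smul' c x := NilAlg.ext (smul_comm _ _ _) (by
    change c • x.2 + β (c • x.1) = c • (x.2 + β x.1)
    rw [map_smul, smul_add])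

theorem shear_shear {ε : ℝ} (hε : ε * ε = 1) (β : V →ₗ[ℝ] V') (x : NilAlg) :
    shear ε (-ε • β) (shear ε β x) = x := by
  apply NilAlg.ext
  · change ε • ε • x.1 = x.1
    rw [smul_smul, hε, one_smul]
  · change x.2 + β x.1 + (-ε • β) (ε • x.1) = x.2
    rw [LinearMap.smul_apply, map_smul, smul_smul, neg_mul, hε]
    module

/-- The bracket takes values in `V'`, where the shear is the identity, and it sees only the
`V`-parts, where the two signs cancel. -/
theorem shear_lie {ε : ℝ} (hε : ε * ε = 1) (β : V →ₗ[ℝ] V') (x y : NilAlg) :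
    shear ε β ⁅x, y⁆ = ⁅shear ε β x, shear ε β y⁆ := by
  apply NilAlg.ext
  · change ε • (0 : V) = 0
    rw [smul_zero]
  · change wedgeMod x.1 y.1 + β 0 = wedgeMod (ε • x.1) (ε • y.1)
    rw [map_zero, add_zero, map_smul, map_smul, LinearMap.smul_apply, smul_smul, hε, one_smul]

/-- The automorphism of `G` with differential `shear ε β`. -/
noncomputable def shearEquiv {ε : ℝ} (hε : ε * ε = 1) (β : V →ₗ[ℝ] V') :
    NilGroup ≃ₜ* NilGroup where
  toFun g := NilGroup.exp (shear ε β g.log)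
  invFun g := NilGroup.exp (shear ε (-ε • β) g.log)
  left_inv g := congrArg NilGroup.exp (shear_shear hε β g.log)
  right_inv g := by
    have h := shear_shear hε (-ε • β) g.log
    rw [smul_smul, neg_mul_neg, hε, one_smul] at h
    exact congrArg NilGroup.exp h
  map_mul' g h := by
    ext1
    rw [NilGroup.log_mul, NilGroup.log_mul, map_add, map_add, map_smul, shear_lie hε]
  continuous_toFun := continuous_exp_comp_log _
  continuous_invFun := continuous_exp_comp_log _

theorem shearEquiv_apply {ε : ℝ} (hε : ε * ε = 1) (β : V →ₗ[ℝ] V') (g : NilGroup) :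
    shearEquiv hε β g = NilGroup.exp (ε • g.log.1, g.log.2 + β g.log.1) := rfl

theorem shearEquiv_theta {ε : ℝ} (hε : ε * ε = 1) (β : V →ₗ[ℝ] V') :
    shearEquiv hε β (θ : NilGroup) = θ := by
  have h := (NilGroup.mem_commutator_iff _).1 θ.2
  rw [shearEquiv_apply]
  ext1
  apply NilAlg.ext
  · change ε • (θ : NilGroup).log.1 = _
    rw [h, smul_zero]
  · change (θ : NilGroup).log.2 + β (θ : NilGroup).log.1 = _
    rw [h, map_zero, add_zero]

/-- The automorphism of `G'` with differential `shear ε β`. -/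
noncomputable def quoShear {ε : ℝ} (hε : ε * ε = 1) (β : V →ₗ[ℝ] V') : Quo θ ≃ₜ* Quo θ :=
  { QuotientGroup.congr (Subgroup.zpowers (θ : NilGroup)) (Subgroup.zpowers (θ : NilGroup))
      (shearEquiv hε β).toMulEquiv (by
        rw [MonoidHom.map_zpowers]
        exact congrArg Subgroup.zpowers (shearEquiv_theta θ hε β)) with
    continuous_toFun := by
      apply continuous_quot_lift
      exact continuous_quot_mk.comp (shearEquiv hε β).continuous
    continuous_invFun := by
      apply continuous_quot_lift
      exact continuous_quot_mk.comp (shearEquiv hε β).symm.continuous }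

theorem quoShear_mk {ε : ℝ} (hε : ε * ε = 1) (β : V →ₗ[ℝ] V') (g : NilGroup) :
    quoShear θ hε β (QuotientGroup.mk g) = QuotientGroup.mk (shearEquiv hε β g) := rfl

theorem exists_linearMap_apply_eq {v : V} (hv : v ≠ 0) (z : V') : ∃ β : V →ₗ[ℝ] V', β v = z := by
  obtain ⟨i, j, hij⟩ : ∃ i j, v.1 i j ≠ 0 := by
    by_contra! h
    exact hv (Subtype.ext (Matrix.ext h))
  refine ⟨(entry i j).smulRight ((v.1 i j)⁻¹ • z), ?_⟩
  rw [LinearMap.smulRight_apply, entry_apply, smul_smul, mul_inv_cancel₀ hij, one_smul]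

theorem mem_smul_commutator_iff (g x : Quo θ) :
    x ∈ g • (commutator (Quo θ) : Set (Quo θ)) ↔
      Multiplicative.toAdd (quoToV θ x) = Multiplicative.toAdd (quoToV θ g) := by
  rw [Set.mem_smul_set_iff_inv_smul_mem, smul_eq_mul, SetLike.mem_coe, mem_commutator_quo_iff,
    map_mul, map_inv, inv_mul_eq_one]
  exact eq_comm

/-- As `g` has nonzero `V`-part, `β` can be chosen to send that part to the difference of the
`V'`-parts of the lifts of `x` and `g`. -/
theorem exists_automorphism {ε : ℝ} (hε : ε * ε = 1) {g x : Quo θ}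
    (hg : g ∉ commutator (Quo θ))
    (hx : Multiplicative.toAdd (quoToV θ x) = ε • Multiplicative.toAdd (quoToV θ g)) :
    x ∈ autOrbit g := by
  obtain ⟨g, rfl⟩ := QuotientGroup.mk_surjective g
  obtain ⟨x, rfl⟩ := QuotientGroup.mk_surjective x
  have hv : g.log.1 ≠ 0 := by
    intro h
    apply hg
    rw [mem_commutator_quo_iff, quoToV_mk, h]
    rfl
  obtain ⟨β, hβ⟩ := exists_linearMap_apply_eq hv (x.log.2 - g.log.2)
  refine ⟨quoShear θ hε β, ?_⟩
  change quoShear θ hε β (QuotientGroup.mk g) = _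
  rw [quoShear_mk, shearEquiv_apply, hβ, add_sub_cancel]
  refine congrArg QuotientGroup.mk ?_
  ext1
  exact NilAlg.ext (Eq.symm hx) rfl

end

end SmallAut

theorem mainTheorem3 :
    ∃ E : Set (commutator SmallAut.NilGroup), SmallAut.IsLebesgueNull E ∧
      ∀ θ : commutator SmallAut.NilGroup, θ ∉ E →
        IsClosed (commutator (SmallAut.Quo θ) : Set (SmallAut.Quo θ)) ∧
        (∀ τ : SmallAut.Quo θ ≃ₜ* SmallAut.Quo θ,
          (∀ x, SmallAut.factor τ x = x) ∨ (∀ x, SmallAut.factor τ x = x⁻¹)) ∧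
        (∀ g : SmallAut.Quo θ, g ∉ commutator (SmallAut.Quo θ) →
          SmallAut.autOrbit g =
            g • (commutator (SmallAut.Quo θ) : Set (SmallAut.Quo θ)) ∪
              g⁻¹ • (commutator (SmallAut.Quo θ) : Set (SmallAut.Quo θ)) ∧
          g • (commutator (SmallAut.Quo θ) : Set (SmallAut.Quo θ)) ≠
            g⁻¹ • (commutator (SmallAut.Quo θ) : Set (SmallAut.Quo θ))) ∧
        (∀ g ∈ commutator (SmallAut.Quo θ), SmallAut.autOrbit g = {g}) := by
  open SmallAut in
  refine ⟨{θ | (θ : NilGroup).log.2 ∈ degenerate}, ?_, fun θ hθ => ⟨isClosed_commutator_quo θ, ?_⟩⟩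
  · refine MeasureTheory.measure_mono_null ?_ volume_degenerate
    rintro _ ⟨θ, hθ, rfl⟩
    exact ⟨_, hθ, rfl⟩
  have hrigid := automorphism_rigid θ hθ
  have hinv : ∀ g : Quo θ, Multiplicative.toAdd (quoToV θ g⁻¹) =
      -Multiplicative.toAdd (quoToV θ g) := fun g => by rw [map_inv, toAdd_inv]
  refine ⟨fun τ => ?_, fun g hg => ⟨?_, ?_⟩, fun g hg => ?_⟩
  · obtain ⟨ε, hε, h, -⟩ := hrigid τ
    rcases hε with rfl | rfl
    · refine Or.inl fun x => ?_
      obtain ⟨g, rfl⟩ := QuotientGroup.mk_surjective x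
      change QuotientGroup.mk (τ g) = QuotientGroup.mk g
      rw [eq_comm, QuotientGroup.eq, mem_commutator_quo_iff, map_mul, map_inv, inv_mul_eq_one]
      exact (one_smul ℝ (Multiplicative.toAdd (quoToV θ g))).symm.trans (h g).symm
    · refine Or.inr fun x => ?_
      obtain ⟨g, rfl⟩ := QuotientGroup.mk_surjective x
      change QuotientGroup.mk (τ g) = QuotientGroup.mk g⁻¹
      rw [eq_comm, QuotientGroup.eq, mem_commutator_quo_iff, map_mul, map_inv, inv_mul_eq_one]
      exact (((h g).trans (neg_one_smul_V _)).trans (hinv g).symm).symm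
  · ext x
    rw [Set.mem_union, mem_smul_commutator_iff, mem_smul_commutator_iff, hinv]
    constructor
    · rintro ⟨τ, rfl⟩
      obtain ⟨ε, hε, h, -⟩ := hrigid τ
      rcases hε with rfl | rfl
      · exact Or.inl ((h g).trans (one_smul ℝ _))
      · exact Or.inr ((h g).trans (neg_one_smul_V _))
    · rintro (h | h)
      · exact exists_automorphism θ (ε := 1) (by norm_num) hg (by rw [one_smul]; exact h)
      · exact exists_automorphism θ (ε := -1) (by norm_num) hg
          (h.trans (neg_one_smul_V _).symm)
  · intro h
    have h1 : g ∈ g • (commutator (Quo θ) : Set (Quo θ)) := (mem_smul_commutator_iff θ g g).2 rfl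
    rw [h, mem_smul_commutator_iff, hinv] at h1
    -- Equal cosets would give `v = -v` in `V`, which has no 2-torsion.
    exact hg ((mem_commutator_quo_iff θ g).2 (eq_zero_of_eq_neg h1))
  · ext x
    constructor
    · rintro ⟨τ, rfl⟩
      obtain ⟨-, -, -, h⟩ := hrigid τ
      exact h g hg
    · rintro rfl
      exact ⟨ContinuousMulEquiv.refl _, rfl⟩
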